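/- Let $1<p<\infty$ and $\tau\in\mathbb R$. Let $Bf(z)=\mathrm{p.v.}\,-\frac1\pi\int_{\mathbb C}\frac{f(w)}{(z-w)^2}\,dm_2(w)$ be the Ahlfors--Beurling operator, and let $\operatorname{Re}B$ and $\operatorname{Im}B$ be the principal value convolution operators whose kernels are the real and the imaginary part of the kernel $-\frac{1}{\pi z^2}$, so that $B=\operatorname{Re}B+i\operatorname{Im}B$. Let $T$ be $\operatorname{Re}B$ or $\operatorname{Im}B$. Then $T$ is a Fourier multiplier operator: there is a bounded function $m:\mathbb C\to\mathbb R$, continuous except possibly at $0$, such that, for every Schwartz function $f$ and every $z$, the principal value defining $Tf(z)$ exists and equals $T_mf(z)$, where $T_mf=(m\widehat f)^\vee$. For every such $m$ the following hold. (1) On the unit circle $m$ attains the maximum value $1$ and the minimum value $-1$. (2) Let $M=\begin{pmatrix}m\\ \tau\end{pmatrix}$ and $T_Mf=(M\widehat f)^\vee=(T_mf,\tau f)$, and let $$\|T_M\|_{L^p(\mathbb C,\mathbb C)\to L^p(\mathbb C,\mathbb C^2)}=\sup_{f}\frac{\|T_Mf\|_{L^p(\mathbb C,\mathbb C^2)}}{\|f\|_{L^p(\mathbb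 C)}},$$ the supremum being over nonzero Schwartz functions $f:\mathbb C\to\mathbb C$ and $\mathbb C^2$ having its Euclidean norm. Then $$\|T_M\|_{L^p(\mathbb C,\mathbb C)\to L^p(\mathbb C,\mathbb C^2)}\ \ge\ C^\tau_{p,p}.$$ Here, with $r_0,r_1,\dots$ independent random variables taking the values $\pm1$ with probability $\frac12$ each, $$C^\tau_{p,p}=\sup\frac{\left\|\sum_{k=1}^N\begin{pmatrix}\beta_k\\ \tau\end{pmatrix}d_k(r_0,\dots,r_{k-1})\,r_k\right\|_p}{\left\|\sum_{k=1}^N d_k(r_0,\dots,r_{k-1})\,r_k\right\|_p},$$ the supremum being over all $N$, all signs $\beta_k\in\{\pm1\}$ and all functions $d_k:\{\pm1\}^k\to\mathbb C$ for which the denominator is not zero. (3) Let $p^*=\max\{p,\frac p{p-1}\}$. If $1<p<2$ and $\tau^2\le p^*-1$, or if $2\le p<\infty$ and $\tau\in\mathbb R$, then $$\|T_M\|_{L^p(\mathbb C,\mathbb C)\to L^p(\mathbb C,\mathbb C^2)}\ \ge\ \left((p^*-1)^2+\tau^2\right)^{1/2}.$$ -/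

import Mathlib

open MeasureTheory Filter Topology Complex
open scoped FourierTransform SchwartzMap ENNReal

noncomputable section

/-! ### Fourier multipliers on the plane `ℂ = ℝ²` -/

/-- The scalar multiplier operator `T_m f = (m f̂)^∨`. -/
def multiplierOp (m : ℂ → ℂ) (f : ℂ → ℂ) : ℂ → ℂ :=
  𝓕⁻ (fun ξ => m ξ * (𝓕 f) ξ)

/-- The vector-valued multiplier operator `T_M f = (M f̂)^∨`, the inverse Fourier transform being
taken component by component. -/
def vectorMultiplierOp {n : ℕ} (M : Fin n → ℂ → ℂ) (f : ℂ → ℂ) : ℂ → EuclideanSpace ℂ (Fin n) :=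
  fun z => WithLp.toLp 2 (fun i => multiplierOp (M i) f z)

/-- The norm `‖T_M‖` from `L^p(ℂ, ℂ)` to `L^{p₀}(ℂ, ℂⁿ)`, computed on Schwartz functions
(with values in `[0, ∞]`; the function `f = 0` contributes `0 / 0 = 0`). -/
def vectorMultiplierNorm {n : ℕ} (M : Fin n → ℂ → ℂ) (p p₀ : ℝ) : ℝ≥0∞ :=
  ⨆ f : 𝓢(ℂ, ℂ), eLpNorm (vectorMultiplierOp M f) (ENNReal.ofReal p₀) volume /
    eLpNorm f (ENNReal.ofReal p) volume

/-! ### The Ahlfors–Beurling operator -/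

/-- The kernel `-1 / (π z²)` of the Ahlfors–Beurling operator `B`. -/
def beurlingKernel (z : ℂ) : ℂ := -(1 / (Real.pi * z ^ 2))

/-- The kernel of `Re B`. On real-valued functions `(Re B) f = Re (B f)`. -/
def reBeurlingKernel (z : ℂ) : ℝ := (beurlingKernel z).re

/-- The kernel of `Im B`. On real-valued functions `(Im B) f = Im (B f)`; thus
`B = Re B + i Im B`. -/
def imBeurlingKernel (z : ℂ) : ℝ := (beurlingKernel z).im

/-- The principal value `p.v. ∫ k(z - w) f(w) dm₂(w)` exists and equals `a`. -/
def HasPrincipalValue (k : ℂ → ℝ) (f : ℂ → ℂ) (z a : ℂ) : Prop :=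
  Tendsto (fun ε : ℝ => ∫ w in {w : ℂ | ε < ‖z - w‖}, (k (z - w) : ℂ) * f w) (𝓝[>] 0) (𝓝 a)

/-- `m` is the multiplier corresponding to the principal value operator
`T f(z) = p.v. ∫ k(z - w) f(w) dm₂(w)`: it is bounded, continuous except possibly at zero, and on
Schwartz functions `T` exists and is `T_m`. These conditions determine `m` away from zero. -/
structure IsMultiplierOf (m : ℂ → ℝ) (k : ℂ → ℝ) : Prop where
  bounded : ∃ C : ℝ, ∀ ξ, |m ξ| ≤ C
  continuousOn : ContinuousOn m {0}ᶜ
  eq_op : ∀ (f : 𝓢(ℂ, ℂ)) (z : ℂ),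
    HasPrincipalValue k f z (multiplierOp (fun ξ => (m ξ : ℂ)) f z)

/-! ### The perturbed martingale transform

The signs `r₀, …, r_N` are realized as the coordinates of `Fin (N + 1) → ℤˣ` with the uniform
probability. -/

/-- The `L^p` norm of a random variable depending on the independent fair signs `r₀, …, r_N`. -/
def signLpNorm {N : ℕ} {E : Type*} [Norm E] (p : ℝ) (X : (Fin (N + 1) → ℤˣ) → E) : ℝ :=
  ((∑ r, ‖X r‖ ^ p) / 2 ^ (N + 1)) ^ (1 / p)

/-- The martingale `∑_{k=1}^N β_k d_k(r₀, …, r_{k-1}) r_k`. Here `k : Fin N` counts from `0`, so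
that `d k` and `β k` are the `d_{k+1}` and `β_{k+1}` of this formula. -/
def martingaleTransform {N : ℕ} (β : Fin N → ℤˣ)
    (d : ∀ k : Fin N, (Fin (k.val + 1) → ℤˣ) → ℂ) (r : Fin (N + 1) → ℤˣ) : ℂ :=
  ∑ k : Fin N, ((β k : ℤ) : ℂ) *
    d k (fun i => r (Fin.castLE (Nat.succ_le_succ k.isLt.le) i)) * ((r k.succ : ℤ) : ℂ)

/-- The constant `C^τ_{p,p₀}`: the norm, from `L^p(ℂ)` to `L^{p₀}(ℂ²)`, of the map
`F_N ↦ (G_N, τ F_N)`, where `G_N` is the transform of `F_N` by signs `β_k`, over all `N`, all signs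
and all martingales (with values in `[0, ∞]`; `F_N = 0` contributes `0`). -/
def martingaleConst (τ p p₀ : ℝ) : ℝ≥0∞ :=
  ⨆ (N : ℕ) (β : Fin N → ℤˣ) (d : ∀ k : Fin N, (Fin (k.val + 1) → ℤˣ) → ℂ),
    ENNReal.ofReal
      (signLpNorm p₀ (fun r =>
          (!₂[martingaleTransform β d r, (τ : ℂ) * martingaleTransform 1 d r] :
            EuclideanSpace ℂ (Fin 2))) /
        signLpNorm p (fun r => martingaleTransform 1 d r))

/-- `p* = max {p, p / (p - 1)}`. -/
def pStar (p : ℝ) : ℝ := max p (p / (p - 1))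

end

/-! Up to constants the kernels of Re B and Im B are q(w)/|w|⁴ with q a harmonic quadratic form, and
q(w) exp(-t|w|²) has Fourier transform -(π/t)³ q(ξ) exp(-π²|ξ|²/t). Integrating against t dt turns
the kernel into the symbol -π q(ξ)/|ξ|² (`integral_saddleKernel_eq`). The symbols are therefore (x²
- y²)/|ξ|² and -2xy/|ξ|²: real, even, homogeneous of degree 0, with extreme values ±1.

Only these properties enter the norm estimates. On functions modulated by a frequency going to
infinity in the direction v, such a multiplier acts asymptotically as the scalar m(v). Under z ↦
(L^(i+1) ⟪vᵢ, z⟫)ᵢ a monomial of the torus whose last nonzero index is k becomes a modulation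
essentially in the direction v_k, and for large L the images equidistribute. So T_M controls the
operator on the torus that multiplies the part with last index k by m(v_k) (`torus_transference`).
With m(v_k) = ±1 and square waves as independent signs, any bound A for T_M bounds all sign
transforms of Paley–Walsh martingales (`martingale_transference`); this is the comparison with C^τ.

For the explicit constant, the bound A means that V(x, y) = (y² + τ²x²)^(p/2) - A^p |x|^p has
nonpositive expectation along every zigzag martingale from the origin. The supremum W of the
expectations from (x, y) is then finite, homogeneous of degree p and midpoint concave along (1, ±1).
An infinitesimal zigzag from (0, 1) back to the y-axis forces V(1/p, 1 - 1/p) ≤ 0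
(`zigzag_obstruction`), that is, (p - 1)² + τ² ≤ A². Exchanging the coordinates replaces p - 1 by
1/(p - 1), and the larger of the two is p* - 1. -/

noncomputable section

/-! ### The quadratic harmonic kernels and their Fourier transforms -/

/-- The harmonic quadratic form `⟪a, w⟫ ⟪i a, w⟫` on the plane. -/
def saddle (a w : ℂ) : ℝ := inner ℝ a w * inner ℝ (I * a) w

lemma saddle_I_mul (a w : ℂ) : saddle a (I * w) = -saddle a w := by
  simp [saddle, Complex.inner]; ring

lemma abs_saddle_le (a w : ℂ) : |saddle a w| ≤ ‖a‖ ^ 2 * ‖w‖ ^ 2 := by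
  rw [saddle, abs_mul]
  calc _ ≤ (‖a‖ * ‖w‖) * (‖I * a‖ * ‖w‖) := by
        gcongr <;> exact abs_real_inner_le_norm _ _
    _ = _ := by simp; ring

@[fun_prop]
lemma continuous_saddle (a : ℂ) : Continuous (saddle a) := by unfold saddle; fun_prop

lemma saddle_smul (a : ℂ) (c : ℝ) (w : ℂ) : saddle a (c * w) = c ^ 2 * saddle a w := by
  simp [saddle, Complex.inner]; ring

lemma integrable_norm_pow_mul_gaussian (n : ℕ) {t : ℝ} (ht : 0 < t) :
    Integrable fun w : ℂ => ‖w‖ ^ n * Real.exp (-t * ‖w‖ ^ 2) := by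
  refine (integrable_fun_norm_addHaar (E := ℂ) volume
    (f := fun y => y ^ n * Real.exp (-t * y ^ 2))).2 ?_
  have := integrableOn_rpow_mul_exp_neg_mul_rpow (p := 2) (s := (n + 1 : ℕ)) (b := t)
    (by have : (0 : ℝ) ≤ ((n + 1 : ℕ) : ℝ) := by positivity
        linarith) (by norm_num) ht
  refine this.congr_fun (fun y hy => ?_) measurableSet_Ioi
  simp only [Real.rpow_natCast]
  simp [Complex.finrank_real_complex, pow_succ]
  ring

lemma fourier_inner_grad {g : ℂ → ℝ} {G : ℂ → ℂ} (hg : Integrable g) (hG : Integrable G)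
    (h : ∀ w, HasFDerivAt g (innerSL ℝ (G w)) w) (v ξ : ℂ) :
    𝓕 (fun w => ((inner ℝ (G w) v : ℝ) : ℂ)) ξ =
      2 * Real.pi * I * (inner ℝ ξ v : ℝ) * 𝓕 (fun w => (g w : ℂ)) ξ := by
  have hd : ∀ w, HasFDerivAt (fun w => (g w : ℂ)) (ofRealCLM.comp (innerSL ℝ (G w))) w :=
    fun w => ofRealCLM.hasFDerivAt.comp w (h w)
  have hfd : fderiv ℝ (fun w => (g w : ℂ)) = fun w => ofRealCLM.comp (innerSL ℝ (G w)) :=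
    funext fun w => (hd w).fderiv
  have hf' : Integrable (fderiv ℝ (fun w => (g w : ℂ))) := by
    rw [hfd]
    exact ((ContinuousLinearMap.compL ℝ ℂ ℝ ℂ ofRealCLM).comp
      (innerSL ℝ : ℂ →L[ℝ] ℂ →L[ℝ] ℝ)).integrable_comp hG
  have h1 := Real.fourier_continuousLinearMap_apply (a := v) (v := ξ) hf'
  rw [Real.fourier_fderiv hg.ofReal (fun w => (hd w).differentiableAt) hf', hfd] at h1
  simp only [ContinuousLinearMap.comp_apply, ofRealCLM_apply, innerSL_apply_apply ℝ] at h1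
  rw [← h1, VectorFourier.fourierSMulRight_apply]
  simp only [neg_apply, innerSL_apply_apply ℝ, real_smul, smul_eq_mul]
  push_cast
  ring

lemma fourier_congr_mul {f : ℂ → ℂ} (c : ℂ) (ξ : ℂ) :
    𝓕 (fun w => c * f w) ξ = c * 𝓕 f ξ := by
  simp only [Real.fourier_eq', smul_eq_mul, ← integral_const_mul]
  congr 1; ext; ring

lemma hasFDerivAt_gaussian (t : ℝ) (w : ℂ) :
    HasFDerivAt (fun w : ℂ => Real.exp (-t * ‖w‖ ^ 2))
      (innerSL ℝ ((-2 * t * Real.exp (-t * ‖w‖ ^ 2)) • w)) w := by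
  have h1 : HasFDerivAt (fun w : ℂ => -t * ‖w‖ ^ 2) ((-2 * t) • innerSL ℝ w) w := by
    refine ((hasStrictFDerivAt_norm_sq w).hasFDerivAt.const_mul (-t)).congr_fderiv ?_
    refine ContinuousLinearMap.ext fun v => ?_
    simp only [smul_apply, innerSL_apply_apply ℝ, smul_eq_mul, nsmul_eq_mul]
    push_cast; ring
  refine h1.exp.congr_fderiv (ContinuousLinearMap.ext fun v => ?_)
  simp only [smul_apply, innerSL_apply_apply ℝ, smul_eq_mul, real_inner_smul_left]
  ring

lemma hasFDerivAt_inner_mul_gaussian (t : ℝ) (a w : ℂ) :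
    HasFDerivAt (fun w : ℂ => inner ℝ a w * Real.exp (-t * ‖w‖ ^ 2))
      (innerSL ℝ (Real.exp (-t * ‖w‖ ^ 2) • a +
        (-2 * t * (inner ℝ a w * Real.exp (-t * ‖w‖ ^ 2))) • w)) w := by
  refine ((innerSL ℝ a).hasFDerivAt.mul (hasFDerivAt_gaussian t w)).congr_fderiv
    (ContinuousLinearMap.ext fun v => ?_)
  simp only [smul_apply, add_apply, innerSL_apply_apply ℝ, smul_eq_mul, inner_add_left,
    real_inner_smul_left]
  ring

lemma inner_I_mul_self (a : ℂ) : inner ℝ a (I * a) = 0 := by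
  simp [Complex.inner]; ring

lemma integrable_of_norm_le_pow_gaussian {E : Type*} [NormedAddCommGroup E] {t : ℝ} (ht : 0 < t)
    {f : ℂ → E} (hf : Continuous f) (n : ℕ) (C : ℝ)
    (h : ∀ w, ‖f w‖ ≤ C * (‖w‖ ^ n * Real.exp (-t * ‖w‖ ^ 2))) : Integrable f :=
  ((integrable_norm_pow_mul_gaussian n ht).const_mul C).mono' hf.aestronglyMeasurable
    (Eventually.of_forall h)

/-- The Fourier transform of a harmonic quadratic form times a Gaussian. -/
lemma fourier_saddle_mul_gaussian (a ξ : ℂ) {t : ℝ} (ht : 0 < t) :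
    𝓕 (fun w : ℂ => ((saddle a w * Real.exp (-t * ‖w‖ ^ 2) : ℝ) : ℂ)) ξ =
      -(((Real.pi / t) ^ 3 * saddle a ξ * Real.exp (-(Real.pi ^ 2 * ‖ξ‖ ^ 2 / t)) : ℝ) : ℂ) := by
  have i0 : Integrable fun w : ℂ => Real.exp (-t * ‖w‖ ^ 2) :=
    integrable_of_norm_le_pow_gaussian ht (by fun_prop) 0 1 fun w => by simp
  have i1 : Integrable fun w : ℂ => ((-2 * t * Real.exp (-t * ‖w‖ ^ 2)) • w : ℂ) :=
    integrable_of_norm_le_pow_gaussian ht (by fun_prop) 1 (2 * t) fun w => by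
      rw [norm_smul]; simp [abs_of_pos ht]; apply le_of_eq; ring
  have i2 : Integrable fun w : ℂ => inner ℝ a w * Real.exp (-t * ‖w‖ ^ 2) :=
    integrable_of_norm_le_pow_gaussian ht (by fun_prop) 1 ‖a‖ fun w => by
      rw [norm_mul, Real.norm_eq_abs, Real.norm_eq_abs, Real.abs_exp, ← mul_assoc, pow_one]
      gcongr; exact abs_real_inner_le_norm a w
  have i3 : Integrable fun w : ℂ => (-2 * t * (inner ℝ a w * Real.exp (-t * ‖w‖ ^ 2))) • w :=
    integrable_of_norm_le_pow_gaussian ht (by fun_prop) 2 (2 * t * ‖a‖) fun w => by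
      have := abs_real_inner_le_norm a w
      rw [norm_smul]
      simp only [norm_mul, Real.norm_eq_abs, Real.abs_exp, abs_neg, abs_of_pos ht]
      rw [abs_two]
      calc 2 * t * (|inner ℝ a w| * Real.exp (-t * ‖w‖ ^ 2)) * ‖w‖
          ≤ 2 * t * ((‖a‖ * ‖w‖) * Real.exp (-t * ‖w‖ ^ 2)) * ‖w‖ := by gcongr
        _ = 2 * t * ‖a‖ * (‖w‖ ^ 2 * Real.exp (-t * ‖w‖ ^ 2)) := by ring
  have hG : 𝓕 (fun w : ℂ => ((Real.exp (-t * ‖w‖ ^ 2) : ℝ) : ℂ)) ξ =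
      ((Real.pi / t * Real.exp (-(Real.pi ^ 2 * ‖ξ‖ ^ 2 / t)) : ℝ) : ℂ) := by
    have := fourier_gaussian_innerProductSpace (V := ℂ) (b := (t : ℂ)) (by simpa using ht) ξ
    simp only [Complex.finrank_real_complex] at this
    convert this using 2
    · push_cast; rfl
    · push_cast; norm_num; left; congr 1; ring
  -- The form arises by differentiating the Gaussian along `a` and then along `I * a`. These
  -- directions are orthogonal, so the product rule leaves no term without the form.
  have e1 := fourier_inner_grad i0 i1 (hasFDerivAt_gaussian t) a ξ
  have e2 := fourier_inner_grad i2 ((i0.smul_const a).add i3)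
    (hasFDerivAt_inner_mul_gaussian t a) (I * a) ξ
  have r1 : (fun w : ℂ => ((inner ℝ ((-2 * t * Real.exp (-t * ‖w‖ ^ 2)) • w) a : ℝ) : ℂ)) =
      fun w => (-2 * t : ℂ) * ((inner ℝ a w * Real.exp (-t * ‖w‖ ^ 2) : ℝ) : ℂ) := by
    ext w; rw [real_inner_smul_left, real_inner_comm]; push_cast; ring
  have r2 : (fun w : ℂ => ((inner ℝ (Real.exp (-t * ‖w‖ ^ 2) • a +
        (-2 * t * (inner ℝ a w * Real.exp (-t * ‖w‖ ^ 2))) • w) (I * a) : ℝ) : ℂ)) =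
      fun w => (-2 * t : ℂ) * ((saddle a w * Real.exp (-t * ‖w‖ ^ 2) : ℝ) : ℂ) := by
    ext w
    rw [inner_add_left, real_inner_smul_left, real_inner_smul_left, inner_I_mul_self, saddle,
      real_inner_comm (I * a) w]
    push_cast; ring
  rw [r1, fourier_congr_mul, hG] at e1
  simp only [Pi.add_apply] at e2
  rw [r2, fourier_congr_mul] at e2
  have ht' : (t : ℂ) ≠ 0 := by exact_mod_cast ht.ne'
  have e1' : 𝓕 (fun w : ℂ => ((inner ℝ a w * Real.exp (-t * ‖w‖ ^ 2) : ℝ) : ℂ)) ξ =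
      -(Real.pi / t * I * (inner ℝ a ξ : ℝ) *
        ((Real.pi / t * Real.exp (-(Real.pi ^ 2 * ‖ξ‖ ^ 2 / t)) : ℝ) : ℂ)) := by
    rw [real_inner_comm]
    field_simp at e1 ⊢
    linear_combination (-1 : ℂ) * e1
  rw [e1'] at e2
  have e2' : 𝓕 (fun w : ℂ => ((saddle a w * Real.exp (-t * ‖w‖ ^ 2) : ℝ) : ℂ)) ξ =
      -(Real.pi / t * I * (inner ℝ (I * a) ξ : ℝ) * (-(Real.pi / t * I * (inner ℝ a ξ : ℝ) *
        ((Real.pi / t * Real.exp (-(Real.pi ^ 2 * ‖ξ‖ ^ 2 / t)) : ℝ) : ℂ)))) := by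
    rw [real_inner_comm]
    refine mul_left_cancel₀ (mul_ne_zero (by norm_num : (-2 : ℂ) ≠ 0) ht') (e2.trans ?_)
    field_simp
  rw [e2', saddle]
  push_cast
  linear_combination (Real.pi / t : ℂ) ^ 3 * (inner ℝ (I * a) ξ : ℝ) * (inner ℝ a ξ : ℝ) *
    cexp (-(Real.pi ^ 2 * ‖ξ‖ ^ 2 / t)) * I_sq

/-! ### Principal values by antisymmetrisation under a quarter turn -/

/-- The average of `f (z - ·)` against the character `1, -1` of a quarter turn. -/
def quarterTurnDiff (f : ℂ → ℂ) (z w : ℂ) : ℂ := (f (z - w) - f (z - I * w)) / 2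

lemma measurePreserving_I_mul : MeasurePreserving (fun w : ℂ => I * w) := by
  exact (rotation (⟨I, by simp [Submonoid.unitSphere]⟩ : Circle)).measurePreserving

lemma measurableEmbedding_I_mul : MeasurableEmbedding (fun w : ℂ => I * w) :=
  measurableEmbedding_mulLeft₀ I_ne_zero

/-- A kernel that changes sign under a quarter turn only sees the antisymmetrised function. -/
lemma integral_mul_eq_quarterTurnDiff {k : ℂ → ℝ} (hk : ∀ w, k (I * w) = -k w) {f : ℂ → ℂ} {z : ℂ}
    (hi : Integrable fun w => (k w : ℂ) * f (z - w)) :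
    ∫ w, (k w : ℂ) * f (z - w) = ∫ w, (k w : ℂ) * quarterTurnDiff f z w := by
  have h1 := measurePreserving_I_mul.integral_comp measurableEmbedding_I_mul
    (fun w => (k w : ℂ) * f (z - w))
  have h2 := (measurePreserving_I_mul.integrable_comp_emb measurableEmbedding_I_mul).2 hi
  simp only [Function.comp_def] at h1 h2
  have h3 : (fun w => (k w : ℂ) * quarterTurnDiff f z w) = fun w =>
      ((k w : ℂ) * f (z - w) + (k (I * w) : ℂ) * f (z - I * w)) / 2 := by
    ext w; rw [hk, quarterTurnDiff]; push_cast; ring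
  rw [h3, integral_div, integral_add hi h2, h1]
  ring

lemma integrable_schwartz_const_sub (f : 𝓢(ℂ, ℂ)) (z : ℂ) : Integrable fun w => f (z - w) :=
  f.integrable.comp_sub_left z

lemma integrable_quarterTurnDiff (f : 𝓢(ℂ, ℂ)) (z : ℂ) : Integrable (quarterTurnDiff f z) :=
  ((integrable_schwartz_const_sub f z).sub ((measurePreserving_I_mul.integrable_comp_emb
    measurableEmbedding_I_mul).2 (integrable_schwartz_const_sub f z))).div_const 2

lemma continuous_quarterTurnDiff (f : 𝓢(ℂ, ℂ)) (z : ℂ) : Continuous (quarterTurnDiff f z) := by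
  unfold quarterTurnDiff
  have := f.continuous
  fun_prop

/-- A Schwartz function is Lipschitz, and the two points compared are at distance at most `2 * ‖w‖`.
The power of `‖w‖` gained here compensates the singularity of the kernel. -/
lemma exists_norm_quarterTurnDiff_le (f : 𝓢(ℂ, ℂ)) :
    ∃ C, 0 ≤ C ∧ ∀ z w, ‖quarterTurnDiff f z w‖ ≤ C * ‖w‖ := by
  obtain ⟨C, hC⟩ := f.decay 0 1
  refine ⟨C, hC.1.le, fun z w => ?_⟩
  have h := Convex.norm_image_sub_le_of_norm_fderiv_le (𝕜 := ℝ) (f := f) (C := C) (s := Set.univ)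
    (fun x _ => f.differentiableAt) (fun x _ => by
      have := hC.2 x
      rwa [pow_zero, one_mul, norm_iteratedFDeriv_one] at this) convex_univ
    (Set.mem_univ (z - I * w)) (Set.mem_univ (z - w))
  rw [quarterTurnDiff, norm_div]
  have h2 : ‖z - w - (z - I * w)‖ ≤ 2 * ‖w‖ := by
    calc _ = ‖I * w - w‖ := by congr 1; ring
      _ ≤ ‖I * w‖ + ‖w‖ := norm_sub_le _ _
      _ = _ := by simp; ring
  calc _ ≤ C * (2 * ‖w‖) / ‖(2 : ℂ)‖ := by
        gcongr; exact h.trans (by gcongr; exact hC.1.le)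
    _ = _ := by simp; ring

/-- Near the origin the gained power leaves `‖w‖⁻¹`, which is integrable in the plane; outside the
unit ball the weight is at most 1. -/
lemma integrable_inv_sq_mul_quarterTurnDiff (f : 𝓢(ℂ, ℂ)) (z : ℂ) :
    Integrable fun w => (‖w‖ ^ 2)⁻¹ * ‖quarterTurnDiff f z w‖ := by
  obtain ⟨C, hC0, hC⟩ := exists_norm_quarterTurnDiff_le f
  have hm : AEStronglyMeasurable (fun w => (‖w‖ ^ 2)⁻¹ * ‖quarterTurnDiff f z w‖) volume := by
    have := (continuous_quarterTurnDiff f z).measurable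
    fun_prop
  rw [← integrableOn_univ, ← Set.union_compl_self (Metric.ball (0 : ℂ) 1)]
  refine IntegrableOn.union ?_ ?_
  · have h1 : IntegrableOn (fun w : ℂ => ‖w‖⁻¹) (Metric.ball 0 1) := by
      refine (integrableOn_fun_norm_addHaar (E := ℂ) volume (f := fun y : ℝ => y⁻¹)).2 ?_
      refine (integrableOn_const (C := (1 : ℝ)) (by simp)).congr_fun (fun y hy => ?_)
        measurableSet_Ioo
      simp [Complex.finrank_real_complex, hy.1.ne']
    refine (h1.const_mul C).mono' hm.restrict (Eventually.of_forall fun w => ?_)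
    rw [norm_mul, norm_norm, norm_inv, norm_pow, norm_norm]
    rcases eq_or_ne w 0 with rfl | hw
    · simp
    calc _ ≤ (‖w‖ ^ 2)⁻¹ * (C * ‖w‖) := by gcongr; exact hC z w
      _ = _ := by have := norm_ne_zero_iff.2 hw; field_simp
  · refine (integrable_quarterTurnDiff f z).norm.integrableOn.mono' hm.restrict ?_
    refine (ae_restrict_iff' Metric.isOpen_ball.measurableSet.compl).2
      (Eventually.of_forall fun w hw => ?_)
    have hw : 1 ≤ ‖w‖ := by simpa using hw
    rw [norm_mul, norm_norm, norm_inv, norm_pow, norm_norm]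
    exact mul_le_of_le_one_left (norm_nonneg _) (inv_le_one_of_one_le₀ (one_le_pow₀ hw))

/-- The kernel `⟪a, w⟫ ⟪i a, w⟫ / |w|⁴`. -/
def saddleKernel (a w : ℂ) : ℝ := saddle a w / ‖w‖ ^ 4

lemma saddleKernel_I_mul (a w : ℂ) : saddleKernel a (I * w) = -saddleKernel a w := by
  simp [saddleKernel, saddle_I_mul, neg_div]

lemma abs_saddleKernel_le (a w : ℂ) : |saddleKernel a w| ≤ ‖a‖ ^ 2 * (‖w‖ ^ 2)⁻¹ := by
  rw [saddleKernel, abs_div, abs_of_nonneg (by positivity : 0 ≤ ‖w‖ ^ 4)]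
  rcases eq_or_ne w 0 with rfl | hw
  · simp
  have := norm_pos_iff.2 hw
  rw [div_le_iff₀ (by positivity)]
  refine (abs_saddle_le a w).trans (le_of_eq ?_)
  field_simp

@[fun_prop]
lemma measurable_saddleKernel (a : ℂ) : Measurable (saddleKernel a) := by
  have := (continuous_saddle a).measurable
  unfold saddleKernel; fun_prop

lemma integrable_saddleKernel_mul_quarterTurnDiff (a : ℂ) (f : 𝓢(ℂ, ℂ)) (z : ℂ) :
    Integrable fun w => (saddleKernel a w : ℂ) * quarterTurnDiff f z w := by
  refine ((integrable_inv_sq_mul_quarterTurnDiff f z).const_mul (‖a‖ ^ 2)).mono' ?_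
    (Eventually.of_forall fun w => ?_)
  · have := (continuous_quarterTurnDiff f z).measurable
    have := measurable_saddleKernel a
    fun_prop
  · rw [norm_mul, norm_real, ← mul_assoc]
    gcongr
    exact abs_saddleKernel_le a w

/-- Discs are invariant under the quarter turn, so the truncated kernel is still antisymmetric and
sees only `quarterTurnDiff`. Against that function the full kernel is absolutely integrable, and
dominated convergence removes the truncation. -/
lemma tendsto_truncated_saddleKernel (a : ℂ) (f : 𝓢(ℂ, ℂ)) (z : ℂ) :
    Tendsto (fun ε : ℝ => ∫ w in {w : ℂ | ε < ‖z - w‖}, (saddleKernel a (z - w) : ℂ) * f w)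
      (𝓝[>] 0) (𝓝 (∫ w, (saddleKernel a w : ℂ) * quarterTurnDiff f z w)) := by
  set k : ℝ → ℂ → ℝ := fun ε => {w : ℂ | ε < ‖w‖}.indicator (saddleKernel a)
  have hmeas : ∀ ε : ℝ, MeasurableSet {w : ℂ | ε < ‖w‖} := fun ε =>
    measurableSet_lt measurable_const measurable_norm
  have hk : ∀ ε w, k ε (I * w) = -k ε w := fun ε w => by
    simp only [k, Set.indicator_apply, Set.mem_ofPred_eq, norm_mul, norm_I, one_mul,
      saddleKernel_I_mul]
    split_ifs <;> simp
  have hkm : ∀ ε, Measurable (k ε) := fun ε => (measurable_saddleKernel a).indicator (hmeas ε)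
  have key : ∀ ε : ℝ, 0 < ε → ∫ w in {w : ℂ | ε < ‖z - w‖}, (saddleKernel a (z - w) : ℂ) * f w =
      ∫ w, (k ε w : ℂ) * quarterTurnDiff f z w := by
    intro ε hε
    rw [← integral_mul_eq_quarterTurnDiff (hk ε), ← integral_sub_left_eq_self _ volume z,
      ← integral_indicator]
    · congr 1; ext w
      simp only [k, Set.indicator_apply, Set.mem_ofPred_eq, sub_sub_cancel]
      split_ifs <;> simp
    · exact measurableSet_lt measurable_const (by fun_prop)
    · refine ((integrable_schwartz_const_sub f z).norm.const_mul (‖a‖ ^ 2 * (ε ^ 2)⁻¹)).mono' ?_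
        (Eventually.of_forall fun w => ?_)
      · have := hkm ε
        have := f.continuous.measurable
        fun_prop
      · rw [norm_mul, norm_real]
        gcongr
        simp only [k, Set.indicator_apply, Set.mem_ofPred_eq]
        split_ifs with h
        · refine (abs_saddleKernel_le a w).trans ?_
          gcongr
        · simp; positivity
  refine Tendsto.congr' (eventually_nhdsWithin_of_forall fun ε hε => (key ε hε).symm) ?_
  refine tendsto_integral_filter_of_dominated_convergence
    (fun w => ‖(saddleKernel a w : ℂ) * quarterTurnDiff f z w‖) ?_ ?_
    (integrable_saddleKernel_mul_quarterTurnDiff a f z).norm ?_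
  · refine Eventually.of_forall fun ε => ?_
    have := hkm ε
    have := (continuous_quarterTurnDiff f z).measurable
    fun_prop
  · refine Eventually.of_forall fun ε => Eventually.of_forall fun w => ?_
    rw [norm_mul, norm_mul]
    gcongr
    simp only [k, Set.indicator_apply, Set.mem_ofPred_eq]
    split_ifs <;> simp
  · refine Eventually.of_forall fun w => ?_
    rcases eq_or_ne w 0 with rfl | hw
    · simp [k, quarterTurnDiff]
    refine tendsto_const_nhds.congr' ?_
    filter_upwards [mem_nhdsWithin_of_mem_nhds (Iio_mem_nhds (norm_pos_iff.2 hw))] with ε hε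
    have : w ∈ {w : ℂ | ε < ‖w‖} := hε
    simp only [k, Set.indicator_of_mem this]

/-! ### Characters, inversion and Parseval's identity -/

/-- The character `e(⟪ω, z⟫)` of the plane. -/
def planeChar (ω z : ℂ) : ℂ := cexp ((2 * Real.pi * inner ℝ ω z : ℝ) * I)

lemma norm_planeChar (ω z : ℂ) : ‖planeChar ω z‖ = 1 := norm_exp_ofReal_mul_I _

@[fun_prop]
lemma continuous_planeChar (ω : ℂ) : Continuous (planeChar ω) := by unfold planeChar; fun_prop

lemma planeChar_comm (ω z : ℂ) : planeChar ω z = planeChar z ω := by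
  rw [planeChar, real_inner_comm, planeChar]

lemma fourierInv_eq_integral_planeChar (g : ℂ → ℂ) (z : ℂ) :
    𝓕⁻ g z = ∫ ξ, planeChar z ξ * g ξ := by
  simp only [Real.fourierInv_eq', smul_eq_mul, planeChar, real_inner_comm]

lemma fourier_eq_integral_planeChar (g : ℂ → ℂ) (z : ℂ) :
    𝓕 g z = ∫ ξ, planeChar (-z) ξ * g ξ := by
  simp only [Real.fourier_eq', smul_eq_mul, planeChar, real_inner_comm, inner_neg_left]
  congr 1; ext; congr 3; ring_nf

lemma planeChar_add_left (ω ω' z : ℂ) : planeChar (ω + ω') z = planeChar ω z * planeChar ω' z := by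
  simp only [planeChar, inner_add_left, ← Complex.exp_add]; congr 1; push_cast; ring

lemma schwartz_fourier_inversion (f : 𝓢(ℂ, ℂ)) (z : ℂ) :
    ∫ ξ, planeChar z ξ * 𝓕 (f : ℂ → ℂ) ξ = f z := by
  rw [← fourierInv_eq_integral_planeChar, ← SchwartzMap.fourier_coe, ← SchwartzMap.fourierInv_coe]
  simp

lemma schwartz_fourier_integrable (f : 𝓢(ℂ, ℂ)) : Integrable (𝓕 (f : ℂ → ℂ)) := by
  rw [← SchwartzMap.fourier_coe]; exact (𝓕 f).integrable

lemma schwartz_fourier_continuous (f : 𝓢(ℂ, ℂ)) : Continuous (𝓕 (f : ℂ → ℂ)) := by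
  rw [← SchwartzMap.fourier_coe]; exact (𝓕 f).continuous

lemma integrable_planeChar_mul {g : ℂ → ℂ} (hg : Integrable g) (z : ℂ) :
    Integrable fun ξ => planeChar z ξ * g ξ :=
  hg.bdd_mul (c := 1) (continuous_planeChar z).aestronglyMeasurable
    (Eventually.of_forall fun ξ => (norm_planeChar z ξ).le)

/-- Parseval's identity for the convolution of an integrable function with a Schwartz function. -/
lemma integral_mul_schwartz_sub {g : ℂ → ℂ} (hg : Integrable g) (f : 𝓢(ℂ, ℂ)) (z : ℂ) :
    ∫ w, g w * f (z - w) = ∫ ξ, 𝓕 g ξ * (planeChar z ξ * 𝓕 (f : ℂ → ℂ) ξ) := by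
  have h := VectorFourier.integral_fourierIntegral_smul_eq_flip (L := innerₗ ℂ)
    Real.continuous_fourierChar continuous_inner hg
    (integrable_planeChar_mul (schwartz_fourier_integrable f) z)
  simp only [smul_eq_mul, flip_innerₗ] at h
  refine Eq.trans ?_ h.symm
  congr 1; ext w
  congr 1
  change _ = 𝓕 (fun ξ => planeChar z ξ * 𝓕 (f : ℂ → ℂ) ξ) w
  rw [fourier_eq_integral_planeChar, ← schwartz_fourier_inversion]
  congr 1; ext ξ
  rw [← mul_assoc, ← planeChar_add_left]
  congr 2; ring

/-! ### Superposition of Gaussians: from the kernel to the symbol -/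

lemma integral_Ioi_mul_exp {r : ℝ} (hr : 0 < r) :
    ∫ t in Set.Ioi (0 : ℝ), t * Real.exp (-t * r) = (r ^ 2)⁻¹ := by
  have := Real.integral_rpow_mul_exp_neg_mul_Ioi (a := 2) two_pos hr
  norm_num at this
  rw [← this]
  congr 1; ext t; ring_nf

lemma integrableOn_Ioi_mul_exp {r : ℝ} (hr : 0 < r) :
    IntegrableOn (fun t => t * Real.exp (-t * r)) (Set.Ioi (0 : ℝ)) := by
  -- The integral of a non-integrable function is 0 by convention, while the computed value is
  -- positive.
  by_contra h
  have := integral_Ioi_mul_exp hr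
  rw [integral_undef h] at this
  exact absurd this.symm (by positivity)

/-- The substitution t ↦ 1/t turns this into the integral of a plain exponential. -/
lemma integral_Ioi_inv_sq_mul_exp {r : ℝ} (hr : 0 < r) :
    ∫ t in Set.Ioi (0 : ℝ), (t ^ 2)⁻¹ * Real.exp (-(r / t)) = r⁻¹ := by
  have h := integral_comp_rpow_Ioi (fun y => Real.exp (-r * y)) (p := -1) (by norm_num)
  rw [integral_exp_mul_Ioi (by linarith)] at h
  have h' : ∫ t in Set.Ioi (0 : ℝ), (t ^ 2)⁻¹ * Real.exp (-(r / t)) =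
      ∫ t in Set.Ioi (0 : ℝ), (|-1| * t ^ ((-1 : ℝ) - 1)) • Real.exp (-r * t ^ (-1 : ℝ)) := by
    refine setIntegral_congr_fun measurableSet_Ioi fun t ht => ?_
    have ht : 0 < t := ht
    rw [show (-1 : ℝ) - 1 = -(2 : ℕ) by norm_num, Real.rpow_neg ht.le, Real.rpow_natCast,
      Real.rpow_neg_one]
    simp [div_eq_mul_inv]
  rw [h', h]
  simp

lemma integrableOn_Ioi_inv_sq_mul_exp {r : ℝ} (hr : 0 < r) :
    IntegrableOn (fun t => (t ^ 2)⁻¹ * Real.exp (-(r / t))) (Set.Ioi (0 : ℝ)) := by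
  by_contra h
  have := integral_Ioi_inv_sq_mul_exp hr
  rw [integral_undef h] at this
  exact absurd this.symm (by positivity)

/-- The homogeneous function `⟪a, ξ⟫ ⟪i a, ξ⟫ / |ξ|²`. -/
def saddleSymbol (a ξ : ℂ) : ℝ := saddle a ξ / ‖ξ‖ ^ 2

lemma abs_saddleSymbol_le (a ξ : ℂ) : |saddleSymbol a ξ| ≤ ‖a‖ ^ 2 := by
  rw [saddleSymbol, abs_div, abs_of_nonneg (by positivity : 0 ≤ ‖ξ‖ ^ 2)]
  exact div_le_of_le_mul₀ (by positivity) (by positivity) (abs_saddle_le a ξ)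

@[fun_prop]
lemma measurable_saddleSymbol (a : ℂ) : Measurable (saddleSymbol a) := by
  have := (continuous_saddle a).measurable
  unfold saddleSymbol; fun_prop

/-- Integration over a family of kernels that is absolutely integrable in the parameter. -/
lemma integral_integral_kernel_swap {K : ℝ → ℂ → ℝ} {k : ℂ → ℝ} {h : ℂ → ℂ}
    (hK : Measurable (Function.uncurry K)) (hh : Measurable h)
    (hint : ∀ w ≠ 0, IntegrableOn (fun t => K t w) (Set.Ioi 0))
    (hval : ∀ w ≠ 0, ∫ t in Set.Ioi (0 : ℝ), K t w = k w)
    (hnorm : ∀ w ≠ 0, ∫ t in Set.Ioi (0 : ℝ), ‖K t w‖ = |k w|)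
    (hkh : Integrable fun w => (k w : ℂ) * h w) :
    ∫ w, (k w : ℂ) * h w = ∫ t in Set.Ioi (0 : ℝ), ∫ w, (K t w : ℂ) * h w := by
  have hne : ∀ᵐ w : ℂ, w ≠ 0 := by simp [ae_iff]
  have hswap : Integrable (Function.uncurry fun (w : ℂ) (t : ℝ) => (K t w : ℂ) * h w)
      (volume.prod (volume.restrict (Set.Ioi (0 : ℝ)))) := by
    have hm : AEStronglyMeasurable (Function.uncurry fun (w : ℂ) (t : ℝ) => (K t w : ℂ) * h w)
        (volume.prod (volume.restrict (Set.Ioi (0 : ℝ)))) := by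
      have : Measurable fun x : ℂ × ℝ => K x.2 x.1 := hK.comp measurable_swap
      simp only [Function.uncurry_def]
      fun_prop
    rw [integrable_prod_iff hm]
    -- By `hnorm` no cancellation occurs in the parameter, so absolute integrability on the product
    -- is that of `k * h`.
    refine ⟨?_, hkh.norm.congr ?_⟩
    · filter_upwards [hne] with w hw
      have := (Integrable.ofReal (𝕜 := ℂ) (hint w hw)).mul_const (h w)
      exact this
    · filter_upwards [hne] with w hw
      simp only [Function.uncurry_apply_pair, norm_mul, norm_real]
      rw [integral_mul_const, hnorm w hw, Real.norm_eq_abs]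
  rw [← integral_integral_swap hswap]
  refine integral_congr_ae ?_
  filter_upwards [hne] with w hw
  rw [integral_mul_const, ← hval w hw]
  congr 1
  exact integral_ofReal.symm

/-- The principal value convolution with `⟪a, w⟫ ⟪i a, w⟫ / |w|⁴` is, up to the factor `-π`, the
multiplier operator with symbol `⟪a, ξ⟫ ⟪i a, ξ⟫ / |ξ|²`. -/
lemma integral_saddleKernel_eq (a : ℂ) (f : 𝓢(ℂ, ℂ)) (z : ℂ) :
    ∫ w, (saddleKernel a w : ℂ) * quarterTurnDiff f z w =
      -Real.pi * multiplierOp (fun ξ => (saddleSymbol a ξ : ℂ)) f z := by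
  have hs := (continuous_saddle a).measurable
  -- Here |w|⁻⁴ is written as the integral of t exp(-t|w|²) over t > 0.
  rw [integral_integral_kernel_swap
    (K := fun t w => saddle a w * (t * Real.exp (-t * ‖w‖ ^ 2)))
    (by simp only [Function.uncurry_def]; fun_prop) (continuous_quarterTurnDiff f z).measurable
    (fun w hw => (integrableOn_Ioi_mul_exp (by positivity)).const_mul _)
    (fun w hw => by
      rw [integral_const_mul, integral_Ioi_mul_exp (by positivity), saddleKernel]
      rw [← pow_mul, div_eq_mul_inv])
    (fun w hw => by
      have : ∫ t in Set.Ioi (0 : ℝ), ‖saddle a w * (t * Real.exp (-t * ‖w‖ ^ 2))‖ =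
          ∫ t in Set.Ioi (0 : ℝ), |saddle a w| * (t * Real.exp (-t * ‖w‖ ^ 2)) := by
        refine setIntegral_congr_fun measurableSet_Ioi fun t ht => ?_
        simp [abs_of_pos (show 0 < t from ht)]
      rw [this, integral_const_mul, integral_Ioi_mul_exp (by positivity), saddleKernel, abs_div,
        abs_of_nonneg (by positivity : 0 ≤ ‖w‖ ^ 4)]
      rw [← pow_mul, div_eq_mul_inv])
    (integrable_saddleKernel_mul_quarterTurnDiff a f z)]
  -- For fixed t the kernel is integrable, so the antisymmetrisation can be undone and Parseval
  -- applied. The power of t is t · (π/t)³ = π³/t².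
  have hpt : ∀ t ∈ Set.Ioi (0 : ℝ),
      ∫ w, ((saddle a w * (t * Real.exp (-t * ‖w‖ ^ 2)) : ℝ) : ℂ) * quarterTurnDiff f z w =
      -∫ ξ, ((Real.pi ^ 3 * saddle a ξ * ((t ^ 2)⁻¹ * Real.exp (-(Real.pi ^ 2 * ‖ξ‖ ^ 2 / t))) : ℝ)
        : ℂ) * (planeChar z ξ * 𝓕 (f : ℂ → ℂ) ξ) := by
    intro t ht
    have ht : 0 < t := ht
    have hg : Integrable fun w : ℂ => ((saddle a w * Real.exp (-t * ‖w‖ ^ 2) : ℝ) : ℂ) :=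
      integrable_of_norm_le_pow_gaussian ht (by fun_prop) 2 (‖a‖ ^ 2) fun w => by
        rw [norm_real, norm_mul, Real.norm_eq_abs, Real.norm_eq_abs, Real.abs_exp, ← mul_assoc]
        gcongr; exact abs_saddle_le a w
    have hg' : Integrable fun w : ℂ =>
        ((saddle a w * (t * Real.exp (-t * ‖w‖ ^ 2)) : ℝ) : ℂ) := by
      refine (hg.const_mul (t : ℂ)).congr (Eventually.of_forall fun w => ?_)
      push_cast; ring
    have hbd : Integrable fun w : ℂ =>
        ((saddle a w * (t * Real.exp (-t * ‖w‖ ^ 2)) : ℝ) : ℂ) * f (z - w) := by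
      obtain ⟨C, hC⟩ := f.decay 0 0
      refine hg'.mul_bdd (c := C) ?_ (Eventually.of_forall fun w => ?_)
      · have := f.continuous
        exact Continuous.aestronglyMeasurable (by fun_prop)
      · simpa using hC.2 (z - w)
    rw [← integral_mul_eq_quarterTurnDiff (fun w => by
      rw [saddle_I_mul, norm_mul, norm_I, one_mul, neg_mul]) hbd,
      integral_mul_schwartz_sub hg', ← integral_neg]
    congr 1; ext ξ
    have e1 := fourier_saddle_mul_gaussian a ξ ht
    have e2 := fourier_congr_mul
      (f := fun w : ℂ => ((saddle a w * Real.exp (-t * ‖w‖ ^ 2) : ℝ) : ℂ)) (t : ℂ) ξ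
    have e3 : (fun w : ℂ => ((saddle a w * (t * Real.exp (-t * ‖w‖ ^ 2)) : ℝ) : ℂ)) =
        fun w => (t : ℂ) * ((saddle a w * Real.exp (-t * ‖w‖ ^ 2) : ℝ) : ℂ) := by
      ext w; push_cast; ring
    rw [e3, e2, e1]
    have : (t : ℂ) ≠ 0 := by exact_mod_cast ht.ne'
    push_cast
    field_simp
  have hint : Integrable fun ξ => ((Real.pi * saddleSymbol a ξ : ℝ) : ℂ) *
      (planeChar z ξ * 𝓕 (f : ℂ → ℂ) ξ) := by
    refine (integrable_planeChar_mul (schwartz_fourier_integrable f) z).bdd_mul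
      (c := Real.pi * ‖a‖ ^ 2) ?_ (Eventually.of_forall fun ξ => ?_)
    · have := measurable_saddleSymbol a
      fun_prop
    · rw [norm_real, norm_mul, Real.norm_of_nonneg Real.pi_pos.le]
      gcongr; exact abs_saddleSymbol_le a ξ
  have hval : ∀ ξ : ℂ, ξ ≠ 0 → Real.pi ^ 3 * (Real.pi ^ 2 * ‖ξ‖ ^ 2)⁻¹ = Real.pi / ‖ξ‖ ^ 2 := by
    intro ξ hξ
    have := norm_pos_iff.2 hξ
    have := Real.pi_pos
    field_simp
  -- Integrating over t on the frequency side: t⁻² exp(-π²|ξ|²/t) has integral (π²|ξ|²)⁻¹, which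
  -- leaves π times the symbol.
  rw [setIntegral_congr_fun measurableSet_Ioi hpt, integral_neg, ← integral_integral_kernel_swap
    (K := fun t ξ => Real.pi ^ 3 * saddle a ξ *
      ((t ^ 2)⁻¹ * Real.exp (-(Real.pi ^ 2 * ‖ξ‖ ^ 2 / t))))
    (k := fun ξ => Real.pi * saddleSymbol a ξ)
    (by simp only [Function.uncurry_def]; fun_prop) (by
      have := (continuous_planeChar z).measurable
      have := (schwartz_fourier_continuous f).measurable
      fun_prop)
    (fun ξ hξ => (integrableOn_Ioi_inv_sq_mul_exp (by positivity)).const_mul _)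
    (fun ξ hξ => by
      rw [integral_const_mul, integral_Ioi_inv_sq_mul_exp (by positivity), saddleSymbol]
      linear_combination saddle a ξ * hval ξ hξ)
    (fun ξ hξ => by
      have : ∫ t in Set.Ioi (0 : ℝ), ‖Real.pi ^ 3 * saddle a ξ *
          ((t ^ 2)⁻¹ * Real.exp (-(Real.pi ^ 2 * ‖ξ‖ ^ 2 / t)))‖ =
          ∫ t in Set.Ioi (0 : ℝ), Real.pi ^ 3 * |saddle a ξ| *
            ((t ^ 2)⁻¹ * Real.exp (-(Real.pi ^ 2 * ‖ξ‖ ^ 2 / t))) := by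
        congr 1; ext t
        simp [abs_of_pos Real.pi_pos]
      rw [this, integral_const_mul, integral_Ioi_inv_sq_mul_exp (by positivity), saddleSymbol,
        abs_mul, abs_div, abs_of_pos Real.pi_pos, abs_of_nonneg (by positivity : 0 ≤ ‖ξ‖ ^ 2)]
      linear_combination |saddle a ξ| * hval ξ hξ) hint,
    multiplierOp, fourierInv_eq_integral_planeChar, ← integral_const_mul, ← integral_neg]
  congr 1; ext ξ
  push_cast; ring

lemma saddleSymbol_smul (a : ℂ) {c : ℝ} (hc : c ≠ 0) (ξ : ℂ) :
    saddleSymbol a (c * ξ) = saddleSymbol a ξ := by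
  rw [saddleSymbol, saddle_smul, saddleSymbol, norm_mul, norm_real, mul_pow, Real.norm_eq_abs,
    sq_abs, mul_div_mul_left _ _ (pow_ne_zero 2 hc)]

lemma continuousOn_saddleSymbol (a : ℂ) : ContinuousOn (saddleSymbol a) {0}ᶜ := by
  unfold saddleSymbol
  refine (continuous_saddle a).continuousOn.div (by fun_prop) fun ξ hξ => ?_
  exact pow_ne_zero 2 (norm_ne_zero_iff.2 hξ)

lemma multiplierOp_const_mul (c : ℂ) (m f : ℂ → ℂ) (z : ℂ) :
    multiplierOp (fun ξ => c * m ξ) f z = c * multiplierOp m f z := by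
  simp only [multiplierOp, fourierInv_eq_integral_planeChar, ← integral_const_mul]
  congr 1; ext; ring

lemma isMultiplierOf_saddleKernel (a : ℂ) (c : ℝ) :
    IsMultiplierOf (fun ξ => -(Real.pi * c) * saddleSymbol a ξ) (fun w => c * saddleKernel a w) where
  bounded := ⟨Real.pi * |c| * ‖a‖ ^ 2, fun ξ => by
    rw [abs_mul, abs_neg, abs_mul, abs_of_pos Real.pi_pos]
    gcongr; exact abs_saddleSymbol_le a ξ⟩
  continuousOn := continuousOn_const.mul (continuousOn_saddleSymbol a)
  eq_op f z := by
    have h := (tendsto_truncated_saddleKernel a f z).const_mul (c : ℂ)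
    rw [integral_saddleKernel_eq] at h
    unfold HasPrincipalValue
    simp only [ofReal_mul, mul_assoc, integral_const_mul]
    convert h using 2
    have := multiplierOp_const_mul (-(Real.pi * c)) (fun ξ => (saddleSymbol a ξ : ℂ)) f z
    push_cast at this ⊢
    simp only [neg_mul, mul_assoc] at this ⊢
    rw [this]
    ring

/-! ### Uniqueness of the multiplier -/

lemma integrable_mul_fourier {m : ℂ → ℝ} {k : ℂ → ℝ} (hm : IsMultiplierOf m k) (f : 𝓢(ℂ, ℂ)) :
    Integrable fun ξ => (m ξ : ℂ) * 𝓕 (f : ℂ → ℂ) ξ := by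
  obtain ⟨C, hC⟩ := hm.bounded
  refine (schwartz_fourier_integrable f).bdd_mul (c := C) ?_ (Eventually.of_forall fun ξ => ?_)
  · refine Continuous.comp_aestronglyMeasurable continuous_ofReal ?_
    -- Nothing is known of `m` at 0, but a point is null.
    rw [← Measure.restrict_univ (μ := (volume : Measure ℂ)), ← Set.compl_union_self {(0 : ℂ)},
      aestronglyMeasurable_union_iff]
    refine ⟨hm.continuousOn.aestronglyMeasurable (measurableSet_singleton 0).compl, ?_⟩
    rw [Measure.restrict_singleton]
    simp
  · rw [norm_real]; exact hC ξ

/-- The multiplier of a principal value operator is determined away from the origin. -/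
lemma IsMultiplierOf.eqOn {m m' k : ℂ → ℝ} (hm : IsMultiplierOf m k) (hm' : IsMultiplierOf m' k) :
    Set.EqOn m m' {0}ᶜ := by
  -- Evaluated at z = 0 on the inverse transform of g, the operator returns the integral of m g; so
  -- it determines m as a distribution.
  have hz : ∀ g : 𝓢(ℂ, ℂ), ∫ ξ, (m ξ : ℂ) * g ξ = ∫ ξ, (m' ξ : ℂ) * g ξ := by
    intro g
    have h := tendsto_nhds_unique (hm.eq_op (𝓕⁻ g) 0) (hm'.eq_op (𝓕⁻ g) 0)
    have hg : 𝓕 ((𝓕⁻ g : 𝓢(ℂ, ℂ)) : ℂ → ℂ) = g := by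
      rw [← SchwartzMap.fourier_coe]; simp
    simp only [multiplierOp, fourierInv_eq_integral_planeChar, hg] at h
    simpa [planeChar] using h
  have hint : ∀ g : 𝓢(ℂ, ℂ), Integrable (fun ξ => (m ξ : ℂ) * g ξ) ∧
      Integrable (fun ξ => (m' ξ : ℂ) * g ξ) := by
    intro g
    have hg : 𝓕 ((𝓕⁻ g : 𝓢(ℂ, ℂ)) : ℂ → ℂ) = g := by
      rw [← SchwartzMap.fourier_coe]; simp
    have h1 := integrable_mul_fourier hm (𝓕⁻ g)
    have h2 := integrable_mul_fourier hm' (𝓕⁻ g)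
    rw [hg] at h1 h2
    exact ⟨h1, h2⟩
  have hd : ContinuousOn (fun ξ => m ξ - m' ξ) {0}ᶜ := hm.continuousOn.sub hm'.continuousOn
  have hae : ∀ᵐ ξ, ξ ∈ ({0}ᶜ : Set ℂ) → m ξ - m' ξ = 0 := by
    refine isOpen_compl_singleton.ae_eq_zero_of_integral_contDiff_smul_eq_zero
      (hd.locallyIntegrableOn isOpen_compl_singleton.measurableSet) fun g hg hgc _ => ?_
    have hg' : ContDiff ℝ ((⊤ : ℕ∞) : WithTop ℕ∞) (fun ξ => (g ξ : ℂ)) := ofRealCLM.contDiff.comp hg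
    have hgc' : HasCompactSupport (fun ξ => (g ξ : ℂ)) := hgc.comp_left ofReal_zero
    have h1 := hz (hgc'.toSchwartzMap hg')
    obtain ⟨i1, i2⟩ := hint (hgc'.toSchwartzMap hg')
    rw [← sub_eq_zero, ← integral_sub i1 i2] at h1
    refine ofReal_injective ((integral_ofReal (𝕜 := ℂ)).symm.trans ?_)
    rw [ofReal_zero, ← h1]
    congr 1; ext ξ
    simp; ring
  have := Measure.eqOn_open_of_ae_eq (μ := (volume : Measure ℂ)) (U := {0}ᶜ)
    (f := m) (g := m') ?_ isOpen_compl_singleton hm.continuousOn hm'.continuousOn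
  · exact this
  · refine (ae_restrict_iff' (measurableSet_singleton 0).compl).2 ?_
    filter_upwards [hae] with ξ h hξ
    exact sub_eq_zero.1 (h hξ)

lemma IsMultiplierOf.multiplierOp_congr {m m' k : ℂ → ℝ} (hm : IsMultiplierOf m k)
    (hm' : IsMultiplierOf m' k) (f : ℂ → ℂ) (z : ℂ) :
    multiplierOp (fun ξ => (m ξ : ℂ)) f z = multiplierOp (fun ξ => (m' ξ : ℂ)) f z := by
  simp only [multiplierOp, fourierInv_eq_integral_planeChar]
  refine integral_congr_ae ?_
  have hne : ∀ᵐ w : ℂ, w ≠ 0 := by simp [ae_iff]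
  filter_upwards [hne] with ξ hξ
  rw [hm.eqOn hm' hξ]

/-! ### The symbols of Re B and Im B -/

lemma beurlingKernel_eq (w : ℂ) :
    beurlingKernel w = ((-(Real.pi)⁻¹ / ‖w‖ ^ 4 : ℝ) : ℂ) * (starRingEnd ℂ w) ^ 2 := by
  rcases eq_or_ne w 0 with rfl | hw
  · simp [beurlingKernel]
  have hc : starRingEnd ℂ w ≠ 0 := by simpa using hw
  have h4 : ((‖w‖ : ℂ)) ^ 4 = (w * starRingEnd ℂ w) ^ 2 := by
    rw [mul_conj, normSq_eq_norm_sq]; push_cast; ring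
  have := Real.pi_pos.ne'
  rw [beurlingKernel]
  push_cast
  rw [h4]
  field_simp

lemma reBeurlingKernel_eq :
    reBeurlingKernel = fun w => -(Real.pi)⁻¹ * saddleKernel (1 - I) w := by
  ext w
  rw [reBeurlingKernel, beurlingKernel_eq, re_ofReal_mul, saddleKernel, saddle]
  simp [Complex.inner, pow_two]
  ring

lemma imBeurlingKernel_eq :
    imBeurlingKernel = fun w => 2 * (Real.pi)⁻¹ * saddleKernel 1 w := by
  ext w
  rw [imBeurlingKernel, beurlingKernel_eq, im_ofReal_mul, saddleKernel, saddle]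
  simp [Complex.inner, pow_two]
  ring

lemma sq_norm_eq_re_add_im (w : ℂ) : ‖w‖ ^ 2 = w.re ^ 2 + w.im ^ 2 := by
  rw [← normSq_eq_norm_sq, normSq_apply]; ring

/-- The symbols of `Re B` and `Im B`. -/
lemma exists_symbol_of_beurling {k : ℂ → ℝ} (hk : k = reBeurlingKernel ∨ k = imBeurlingKernel) :
    ∃ m : ℂ → ℝ, IsMultiplierOf m k ∧ (∀ c : ℝ, c ≠ 0 → ∀ ξ : ℂ, m (c * ξ) = m ξ) ∧
      (∀ ξ, |m ξ| ≤ 1) ∧ ∀ b : ℤˣ, ∃ u : ℂ, ‖u‖ = 1 ∧ m u = ((b : ℤ) : ℝ) := by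
  have hpi := Real.pi_pos.ne'
  rcases hk with rfl | rfl
  -- For a = 1 - I the form is x² - y², and the constant is -π · (-π⁻¹) = 1. The extremes lie on the
  -- axes.
  · refine ⟨_, reBeurlingKernel_eq ▸ isMultiplierOf_saddleKernel (1 - I) _,
      fun c hc ξ => by rw [saddleSymbol_smul _ hc], fun ξ => ?_, fun b => ?_⟩
    · rw [mul_neg, neg_neg, mul_inv_cancel₀ hpi, one_mul, saddleSymbol, abs_div,
        abs_of_nonneg (by positivity : 0 ≤ ‖ξ‖ ^ 2)]
      refine div_le_one_of_le₀ ?_ (by positivity)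
      rw [sq_norm_eq_re_add_im, abs_le]
      simp only [saddle, Complex.inner]
      simp
      constructor <;> nlinarith [sq_nonneg ξ.re, sq_nonneg ξ.im]
    · rcases Int.units_eq_one_or b with rfl | rfl
      · exact ⟨1, by simp, by simp [saddleSymbol, saddle, hpi]⟩
      · exact ⟨I, by simp, by simp [saddleSymbol, saddle, hpi]⟩
  -- Here the symbol is -2xy/|ξ|², with extremes on the diagonals.
  · refine ⟨_, imBeurlingKernel_eq ▸ isMultiplierOf_saddleKernel 1 _,
      fun c hc ξ => by rw [saddleSymbol_smul _ hc], fun ξ => ?_, fun b => ?_⟩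
    · rw [show -(Real.pi * (2 * Real.pi⁻¹)) = -2 by field_simp, saddleSymbol, abs_mul, abs_div,
        abs_of_nonneg (by positivity : 0 ≤ ‖ξ‖ ^ 2), ← mul_div_assoc]
      refine div_le_one_of_le₀ ?_ (by positivity)
      rw [sq_norm_eq_re_add_im, ← abs_mul, abs_le]
      simp only [saddle, Complex.inner]
      simp
      constructor <;> nlinarith [sq_nonneg (ξ.re + ξ.im), sq_nonneg (ξ.re - ξ.im)]
    · have hs : (√2 : ℝ) ≠ 0 := by positivity
      have hn : ∀ v : ℂ, ‖v‖ ^ 2 = 2 → ‖((√2)⁻¹ : ℝ) * v‖ = 1 := fun v hv => by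
        rw [norm_mul, norm_real, ← Real.sqrt_sq (norm_nonneg v), hv, Real.norm_of_nonneg
          (by positivity), inv_mul_cancel₀ hs]
      have h1 : ‖(1 - I : ℂ)‖ ^ 2 = 2 := by rw [sq_norm_eq_re_add_im]; norm_num
      have h2 : ‖(1 + I : ℂ)‖ ^ 2 = 2 := by rw [sq_norm_eq_re_add_im]; norm_num
      rcases Int.units_eq_one_or b with rfl | rfl
      · refine ⟨((√2)⁻¹ : ℝ) * (1 - I), hn _ h1, ?_⟩
        rw [saddleSymbol_smul _ (inv_ne_zero hs), saddleSymbol, h1]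
        simp [saddle]; field_simp
      · refine ⟨((√2)⁻¹ : ℝ) * (1 + I), hn _ h2, ?_⟩
        rw [saddleSymbol_smul _ (inv_ne_zero hs), saddleSymbol, h2]
        simp [saddle]; field_simp

/-! ### Transference from the plane to the torus -/

/-- The normalised Haar measure of the torus. -/
def torusMeasure (n : ℕ) : Measure (UnitAddTorus (Fin n)) :=
  Measure.pi fun _ => AddCircle.haarAddCircle

instance (n : ℕ) : IsProbabilityMeasure (torusMeasure n) := by
  unfold torusMeasure; infer_instance

/-- The lacunary linear map `z ↦ (L^(i+1) ⟪vᵢ, z⟫)ᵢ` from the plane to the torus. -/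
def lacunaryMap {n : ℕ} (v : Fin n → ℂ) (L : ℕ) (z : ℂ) : UnitAddTorus (Fin n) :=
  fun i => (((L : ℝ) ^ (i.val + 1) * inner ℝ (v i) z : ℝ) : UnitAddCircle)

/-- The frequency of the pull-back of a monomial under `lacunaryMap`. -/
def lacunaryFreq {n : ℕ} (v : Fin n → ℂ) (L : ℕ) (j : Fin n → ℤ) : ℂ :=
  ∑ i, (((j i : ℝ) * (L : ℝ) ^ (i.val + 1) : ℝ) : ℂ) * v i

@[fun_prop]
lemma continuous_lacunaryMap {n : ℕ} (v : Fin n → ℂ) (L : ℕ) : Continuous (lacunaryMap v L) := by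
  refine continuous_pi fun i => ?_
  exact (AddCircle.continuous_mk' 1).comp (by fun_prop)

lemma mFourier_lacunaryMap {n : ℕ} (v : Fin n → ℂ) (L : ℕ) (j : Fin n → ℤ) (z : ℂ) :
    UnitAddTorus.mFourier j (lacunaryMap v L z) = planeChar (lacunaryFreq v L j) z := by
  simp only [UnitAddTorus.mFourier, lacunaryMap, ContinuousMap.coe_mk, planeChar, lacunaryFreq,
    sum_inner, fourier_coe_apply]
  rw [← Complex.exp_sum]
  congr 1
  push_cast
  rw [Finset.mul_sum, Finset.sum_mul]
  refine Finset.sum_congr rfl fun i _ => ?_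
  have : inner ℝ ((j i : ℂ) * (L : ℂ) ^ (i.val + 1) * v i) z =
      (j i * (L : ℝ) ^ (i.val + 1)) * inner ℝ (v i) z := by
    rw [← real_inner_smul_left, real_smul]; push_cast; rfl
  rw [this]
  push_cast; ring

section lacunary
variable {n : ℕ} {v : Fin n → ℂ} {j : Fin n → ℤ} {k : Fin n}

/-- After scaling, `ξ` and the indices below `k` contribute O(1/L), and the indices above `k` are
absent by `hj`. -/
lemma tendsto_scaled_lacunaryFreq (hj : ∀ i, k < i → j i = 0) (ξ : ℂ) :
    Tendsto (fun L : ℕ => ((((L : ℝ) ^ (k.val + 1))⁻¹ : ℝ) : ℂ) * (ξ + lacunaryFreq v L j)) atTop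
      (𝓝 ((j k : ℂ) * v k)) := by
  have hL : Tendsto (fun L : ℕ => (L : ℝ)) atTop atTop := tendsto_natCast_atTop_atTop
  have hinv : ∀ a : ℕ, Tendsto (fun L : ℕ => ((((L : ℝ) ^ (a + 1))⁻¹ : ℝ) : ℂ)) atTop (𝓝 0) := by
    intro a
    rw [← ofReal_zero]
    exact (continuous_ofReal.tendsto 0).comp
      (((tendsto_pow_atTop (Nat.succ_ne_zero a)).comp hL).inv_tendsto_atTop)
  have hterm : ∀ i : Fin n, Tendsto (fun L : ℕ => ((((L : ℝ) ^ (k.val + 1))⁻¹ : ℝ) : ℂ) *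
      ((((j i : ℝ) * (L : ℝ) ^ (i.val + 1) : ℝ) : ℂ) * v i)) atTop
      (𝓝 (if i = k then (j k : ℂ) * v k else 0)) := by
    intro i
    rcases lt_trichotomy i k with h | rfl | h
    · rw [if_neg h.ne]
      obtain ⟨c, hc⟩ := Nat.exists_eq_add_of_lt (show i.val < k.val from h)
      have := (hinv c).mul_const ((j i : ℂ) * v i)
      rw [zero_mul] at this
      refine this.congr' ?_
      filter_upwards [eventually_gt_atTop 0] with L hL
      have : (L : ℂ) ≠ 0 := by exact_mod_cast hL.ne'
      push_cast
      rw [hc]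
      field_simp
      ring
    · rw [if_pos rfl]
      refine tendsto_const_nhds.congr' ?_
      filter_upwards [eventually_gt_atTop 0] with L hL
      have : (L : ℂ) ≠ 0 := by exact_mod_cast hL.ne'
      push_cast
      field_simp
    · simp [hj i h, h.ne']
  have := (((hinv k).mul_const ξ).add (tendsto_finsetSum Finset.univ fun i _ => hterm i))
  simp only [Finset.sum_ite_eq', Finset.mem_univ, if_true, zero_mul, zero_add] at this
  refine this.congr fun L => ?_
  rw [mul_add, lacunaryFreq, Finset.mul_sum]

/-- Nonconstant monomials are pulled back to characters of unbounded frequency, as the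
Riemann–Lebesgue lemma requires. -/
lemma tendsto_lacunaryFreq_cocompact (hv : v k ≠ 0) (hk : j k ≠ 0) (hj : ∀ i, k < i → j i = 0) :
    Tendsto (fun L => lacunaryFreq v L j) atTop (cocompact ℂ) := by
  rw [← Metric.cobounded_eq_cocompact, ← comap_norm_atTop, tendsto_comap_iff]
  have h1 := (tendsto_scaled_lacunaryFreq (v := v) hj 0).norm
  have h2 : 0 < ‖(j k : ℂ) * v k‖ := norm_pos_iff.2 (mul_ne_zero (by exact_mod_cast hk) hv)
  have h3 : Tendsto (fun L : ℕ => (L : ℝ) ^ (k.val + 1)) atTop atTop :=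
    (tendsto_pow_atTop (Nat.succ_ne_zero _)).comp tendsto_natCast_atTop_atTop
  refine (h3.atTop_mul_pos h2 h1).congr' ?_
  filter_upwards [eventually_gt_atTop 0] with L hL
  have : (L : ℝ) ≠ 0 := by exact_mod_cast hL.ne'
  simp only [zero_add, norm_mul, norm_real, Function.comp_apply, norm_inv, norm_pow,
    Real.norm_natCast]
  field_simp

/-- Homogeneity allows the argument to be rescaled to one converging to `j k * v k`, a point of
continuity. Since `hom` admits negative scalars, the sign of `j k` is immaterial. -/
lemma tendsto_symbol_lacunaryFreq {m : ℂ → ℝ} (hcont : ContinuousOn m {0}ᶜ)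
    (hom : ∀ c : ℝ, c ≠ 0 → ∀ ξ : ℂ, m (c * ξ) = m ξ)
    (hv : v k ≠ 0) (hk : j k ≠ 0) (hj : ∀ i, k < i → j i = 0) (ξ : ℂ) :
    Tendsto (fun L => m (ξ + lacunaryFreq v L j)) atTop (𝓝 (m (v k))) := by
  have hne : (j k : ℂ) * v k ≠ 0 := mul_ne_zero (by exact_mod_cast hk) hv
  have hc : ContinuousAt m ((j k : ℂ) * v k) :=
    hcont.continuousAt (isOpen_compl_singleton.mem_nhds hne)
  have h := hc.tendsto.comp (tendsto_scaled_lacunaryFreq (v := v) hj ξ)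
  have e : m ((j k : ℂ) * v k) = m (v k) := by
    have := hom (j k) (by exact_mod_cast hk) (v k)
    push_cast at this
    exact this
  rw [e] at h
  refine h.congr' ?_
  filter_upwards [eventually_gt_atTop 0] with L hL
  have : (L : ℝ) ≠ 0 := by exact_mod_cast hL.ne'
  exact hom _ (by positivity) _

end lacunary

/-- The integral factorises, and translation by half a period of the character changes the sign of a
factor with nonzero frequency. -/
lemma integral_mFourier_torusMeasure {n : ℕ} {j : Fin n → ℤ} (hj : j ≠ 0) :
    ∫ t, UnitAddTorus.mFourier j t ∂torusMeasure n = 0 := by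
  obtain ⟨i, hi⟩ := Function.ne_iff.1 hj
  simp only [UnitAddTorus.mFourier, ContinuousMap.coe_mk, torusMeasure]
  rw [integral_fintype_prod_eq_prod (fun i => (fun x : UnitAddCircle => fourier (j i) x))]
  refine Finset.prod_eq_zero (Finset.mem_univ i) ?_
  exact integral_eq_zero_of_add_right_eq_neg (μ := AddCircle.haarAddCircle)
    (fourier_add_half_inv_index (T := 1) hi one_pos)

lemma exists_top_index {n : ℕ} {j : Fin n → ℤ} (hj : j ≠ 0) :
    ∃ k, j k ≠ 0 ∧ ∀ i, k < i → j i = 0 := by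
  classical
  obtain ⟨i, hi⟩ := Function.ne_iff.1 hj
  set S := Finset.univ.filter fun i => j i ≠ 0
  have hS : S.Nonempty := ⟨i, by simpa [S] using hi⟩
  refine ⟨S.max' hS, by simpa [S] using S.max'_mem hS, fun i hi => ?_⟩
  by_contra h
  exact absurd (S.le_max' i (by simpa [S] using h)) (not_le.2 hi)

lemma tendsto_integral_planeChar_mul (g : ℂ → ℂ) :
    Tendsto (fun ω => ∫ z, planeChar ω z * g z) (cocompact ℂ) (𝓝 0) := by
  have h := tendsto_integral_exp_inner_smul_cocompact (V := ℂ) g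
  have hneg : Tendsto (fun ω : ℂ => -ω) (cocompact ℂ) (cocompact ℂ) :=
    (Homeomorph.neg ℂ).isClosedEmbedding.tendsto_cocompact
  refine (h.comp hneg).congr fun ω => ?_
  simp only [Function.comp_apply]
  congr 1; ext z
  rw [Circle.smul_def, Real.fourierChar_apply, smul_eq_mul, planeChar, inner_neg_right, neg_neg,
    real_inner_comm]

/-- The lacunary images of an absolutely continuous measure equidistribute on the torus. -/
lemma tendsto_integral_lacunaryMap {n : ℕ} {v : Fin n → ℂ} (hv : ∀ i, v i ≠ 0) {g : ℂ → ℂ}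
    (hg : Integrable g) (Φ : C(UnitAddTorus (Fin n), ℂ)) :
    Tendsto (fun L => ∫ z, g z * Φ (lacunaryMap v L z)) atTop
      (𝓝 ((∫ z, g z) * ∫ t, Φ t ∂torusMeasure n)) := by
  have hint : ∀ (Φ : C(UnitAddTorus (Fin n), ℂ)) L,
      Integrable fun z => g z * Φ (lacunaryMap v L z) := fun Φ L =>
    hg.mul_bdd (c := ‖Φ‖) (Continuous.aestronglyMeasurable (by fun_prop))
      (Eventually.of_forall fun z => Φ.norm_coe_le_norm _)
  have hintT : ∀ Φ : C(UnitAddTorus (Fin n), ℂ), Integrable Φ (torusMeasure n) := fun Φ =>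
    Integrable.of_bound Φ.continuous.aestronglyMeasurable ‖Φ‖
      (Eventually.of_forall fun z => Φ.norm_coe_le_norm _)
  have hspan : ∀ Φ ∈ Submodule.span ℂ (Set.range (UnitAddTorus.mFourier (d := Fin n))),
      Tendsto (fun L => ∫ z, g z * Φ (lacunaryMap v L z)) atTop
        (𝓝 ((∫ z, g z) * ∫ t, Φ t ∂torusMeasure n)) := by
    intro Φ hΦ
    induction hΦ using Submodule.span_induction with
    | mem x hx =>
      obtain ⟨j, rfl⟩ := hx
      rcases eq_or_ne j 0 with rfl | hj
      · simp [UnitAddTorus.mFourier_zero]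
      · rw [integral_mFourier_torusMeasure hj, mul_zero]
        obtain ⟨k, hk, hj'⟩ := exists_top_index hj
        refine ((tendsto_integral_planeChar_mul g).comp
          (tendsto_lacunaryFreq_cocompact (hv k) hk hj')).congr fun L => ?_
        simp only [Function.comp_apply, mFourier_lacunaryMap, mul_comm]
    | zero => simp
    | add x y _ _ hx hy =>
      simp only [ContinuousMap.add_apply, mul_add]
      rw [integral_add (hintT x) (hintT y), mul_add]
      exact (hx.add hy).congr fun L => (integral_add (hint x L) (hint y L)).symm
    | smul c x _ hx =>
      simp only [ContinuousMap.smul_apply, smul_eq_mul, mul_left_comm _ c, integral_const_mul]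
      exact hx.const_mul c
  have hcl : Φ ∈ closure (Submodule.span ℂ (Set.range (UnitAddTorus.mFourier (d := Fin n))) :
      Set C(UnitAddTorus (Fin n), ℂ)) := by
    rw [← Submodule.topologicalClosure_coe, UnitAddTorus.span_mFourier_closure_eq_top]
    trivial
  -- Both sides are functionals of Φ of norm at most G, uniformly in L, so convergence passes from
  -- trigonometric polynomials to their uniform closure.
  rw [Metric.tendsto_atTop]
  intro ε hε
  set G := ∫ z, ‖g z‖
  have hG : 0 ≤ G := integral_nonneg fun _ => norm_nonneg _
  obtain ⟨Ψ, hΨ, hd⟩ := Metric.mem_closure_iff.1 hcl (ε / (3 * (G + 1))) (by positivity)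
  obtain ⟨M, hM⟩ := Metric.tendsto_atTop.1 (hspan Ψ hΨ) (ε / 3) (by positivity)
  rw [dist_eq_norm] at hd
  have hδ : G * ‖Φ - Ψ‖ < ε / 3 := by
    calc G * ‖Φ - Ψ‖ ≤ G * (ε / (3 * (G + 1))) := by gcongr
      _ = (G / (G + 1)) * (ε / 3) := by field_simp
      _ < 1 * (ε / 3) := by gcongr; rw [div_lt_one (by positivity)]; linarith
      _ = ε / 3 := one_mul _
  refine ⟨M, fun L hL => ?_⟩
  have h1 : ‖(∫ z, g z * Φ (lacunaryMap v L z)) - ∫ z, g z * Ψ (lacunaryMap v L z)‖ ≤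
      G * ‖Φ - Ψ‖ := by
    rw [← integral_sub (hint Φ L) (hint Ψ L), ← integral_mul_const]
    refine norm_integral_le_of_norm_le (hg.norm.mul_const _) (Eventually.of_forall fun z => ?_)
    rw [← mul_sub, norm_mul]
    gcongr
    exact (Φ - Ψ).norm_coe_le_norm _
  have h2 : ‖(∫ z, g z) * (∫ t, Φ t ∂torusMeasure n) - (∫ z, g z) * ∫ t, Ψ t ∂torusMeasure n‖ ≤
      G * ‖Φ - Ψ‖ := by
    rw [← mul_sub, ← integral_sub (hintT Φ) (hintT Ψ), norm_mul]
    gcongr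
    · exact norm_integral_le_integral_norm _
    · refine (norm_integral_le_of_norm_le_const (C := ‖Φ - Ψ‖)
        (Eventually.of_forall fun t => (Φ - Ψ).norm_coe_le_norm t)).trans ?_
      simp
  have h3 := hM L hL
  rw [dist_eq_norm] at h3 ⊢
  calc _ = ‖((∫ z, g z * Φ (lacunaryMap v L z)) - ∫ z, g z * Ψ (lacunaryMap v L z)) +
        ((∫ z, g z * Ψ (lacunaryMap v L z)) - (∫ z, g z) * ∫ t, Ψ t ∂torusMeasure n) -
        ((∫ z, g z) * (∫ t, Φ t ∂torusMeasure n) - (∫ z, g z) * ∫ t, Ψ t ∂torusMeasure n)‖ := by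
        congr 1; ring
    _ ≤ _ := (norm_sub_le _ _).trans (add_le_add_left (norm_add_le _ _) _)
    _ < ε := by linarith

/-! ### Multipliers acting on modulated functions -/

lemma planeChar_sub_left (ω ω' z : ℂ) :
    planeChar (ω - ω') z = planeChar (-ω') z * planeChar ω z := by
  rw [← planeChar_add_left]; congr 1; ring

lemma fourier_mul_planeChar (f : ℂ → ℂ) (ω ξ : ℂ) :
    𝓕 (fun z => f z * planeChar ω z) ξ = 𝓕 f (ξ - ω) := by
  simp only [fourier_eq_integral_planeChar]
  congr 1; ext z
  rw [neg_sub, planeChar_sub_left]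
  ring

/-- Modulation translates the transform, and a change of variable moves the translation onto the
symbol. -/
lemma multiplierOp_mul_planeChar (m : ℂ → ℂ) (f : ℂ → ℂ) (ω z : ℂ) :
    multiplierOp m (fun z => f z * planeChar ω z) z =
      planeChar ω z * ∫ ξ, planeChar z ξ * (m (ξ + ω) * 𝓕 f ξ) := by
  simp only [multiplierOp, fourierInv_eq_integral_planeChar, fourier_mul_planeChar]
  rw [← integral_add_right_eq_self _ ω, ← integral_const_mul]
  congr 1; ext ξ
  rw [add_sub_cancel_right, planeChar_comm z (ξ + ω), planeChar_add_left, planeChar_comm ξ z]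
  ring

/-- If `m (ξ + ω_L) → β`, then the multiplier `m` acts on functions modulated by `ω_L`
asymptotically as multiplication by `β`. -/
lemma exists_bound_multiplierOp_mul_planeChar {m : ℂ → ℝ} (hm : Measurable m) {C : ℝ}
    (hC : ∀ ξ, |m ξ| ≤ C) {ω : ℕ → ℂ} {β : ℝ} (h : ∀ ξ, Tendsto (fun L => m (ξ + ω L)) atTop (𝓝 β))
    (f : 𝓢(ℂ, ℂ)) :
    ∃ E : ℕ → ℝ, Tendsto E atTop (𝓝 0) ∧ ∀ L z,
      ‖multiplierOp (fun ξ => (m ξ : ℂ)) (fun z => f z * planeChar (ω L) z) z -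
        β * (f z * planeChar (ω L) z)‖ ≤ E L := by
  have hf := schwartz_fourier_integrable f
  -- A function is bounded by the L¹ norm of its transform, so the error is uniform in z; it
  -- vanishes in the limit by dominated convergence.
  refine ⟨fun L => ∫ ξ, ‖((m (ξ + ω L) - β : ℝ) : ℂ) * 𝓕 (f : ℂ → ℂ) ξ‖, ?_, fun L z => ?_⟩
  · have hd := tendsto_integral_of_dominated_convergence (μ := (volume : Measure ℂ))
      (F := fun L ξ => ‖((m (ξ + ω L) - β : ℝ) : ℂ) * 𝓕 (f : ℂ → ℂ) ξ‖) (f := fun _ => 0)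
      (fun ξ => (C + |β|) * ‖𝓕 (f : ℂ → ℂ) ξ‖) (fun L => by
        have := (schwartz_fourier_continuous f).measurable
        fun_prop) (hf.norm.const_mul _) (fun L => Eventually.of_forall fun ξ => by
        rw [norm_norm, norm_mul, norm_real]
        gcongr
        exact (abs_sub _ _).trans (add_le_add_left (hC _) _)) (Eventually.of_forall fun ξ => by
        have h1 := ((h ξ).sub_const β).norm.mul_const ‖𝓕 (f : ℂ → ℂ) ξ‖
        simpa only [sub_self, norm_zero, zero_mul, norm_mul, norm_real] using h1)
    simpa using hd
  · rw [multiplierOp_mul_planeChar, ← schwartz_fourier_inversion f z]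
    have hi : Integrable fun ξ => (m (ξ + ω L) : ℂ) * 𝓕 (f : ℂ → ℂ) ξ := by
      refine hf.bdd_mul (c := C) ?_ (Eventually.of_forall fun ξ => ?_)
      · exact Measurable.aestronglyMeasurable (by fun_prop)
      · rw [norm_real]; exact hC _
    have e : planeChar (ω L) z * (∫ ξ, planeChar z ξ * (m (ξ + ω L) * 𝓕 (f : ℂ → ℂ) ξ)) -
        β * ((∫ ξ, planeChar z ξ * 𝓕 (f : ℂ → ℂ) ξ) * planeChar (ω L) z) =
        planeChar (ω L) z * ∫ ξ, planeChar z ξ *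
          (((m (ξ + ω L) - β : ℝ) : ℂ) * 𝓕 (f : ℂ → ℂ) ξ) := by
      rw [← mul_assoc, mul_comm _ (planeChar (ω L) z), ← mul_sub, ← integral_const_mul,
        ← integral_sub (integrable_planeChar_mul hi z)
          ((integrable_planeChar_mul hf z).const_mul _)]
      congr 2; ext ξ
      push_cast; ring
    rw [e, norm_mul, norm_planeChar, one_mul]
    refine (norm_integral_le_integral_norm _).trans (le_of_eq ?_)
    simp only [norm_mul, norm_planeChar, one_mul]

lemma multiplierOp_schwartz_add {m : ℂ → ℝ} (hm : Measurable m) {C : ℝ} (hC : ∀ ξ, |m ξ| ≤ C)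
    (f g : 𝓢(ℂ, ℂ)) (z : ℂ) :
    multiplierOp (fun ξ => (m ξ : ℂ)) (f + g : 𝓢(ℂ, ℂ)) z =
      multiplierOp (fun ξ => (m ξ : ℂ)) f z + multiplierOp (fun ξ => (m ξ : ℂ)) g z := by
  have hi : ∀ f : 𝓢(ℂ, ℂ), Integrable fun ξ => (m ξ : ℂ) * 𝓕 (f : ℂ → ℂ) ξ := fun f => by
    refine (schwartz_fourier_integrable f).bdd_mul (c := C) ?_ (Eventually.of_forall fun ξ => ?_)
    · fun_prop
    · rw [norm_real]; exact hC _
  have hF : 𝓕 ((f + g : 𝓢(ℂ, ℂ)) : ℂ → ℂ) = 𝓕 (f : ℂ → ℂ) + 𝓕 (g : ℂ → ℂ) := by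
    rw [← SchwartzMap.fourier_coe, ← SchwartzMap.fourier_coe, ← SchwartzMap.fourier_coe,
      FourierTransform.fourier_add]
    rfl
  simp only [multiplierOp, fourierInv_eq_integral_planeChar]
  rw [← integral_add (integrable_planeChar_mul (hi f) z) (integrable_planeChar_mul (hi g) z), hF]
  congr 1; ext ξ
  simp only [Pi.add_apply]; ring

lemma multiplierOp_smul (m f : ℂ → ℂ) (c z : ℂ) :
    multiplierOp m (fun z => c * f z) z = c * multiplierOp m f z := by
  simp only [multiplierOp, fourierInv_eq_integral_planeChar, fourier_congr_mul,
    ← integral_const_mul]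
  congr 1; ext; ring

lemma multiplierOp_const (c : ℂ) (f : 𝓢(ℂ, ℂ)) (z : ℂ) :
    multiplierOp (fun _ => c) f z = c * f z := by
  simp only [multiplierOp, fourierInv_eq_integral_planeChar]
  rw [← schwartz_fourier_inversion f z, ← integral_const_mul]
  congr 1; ext; ring

lemma continuous_multiplierOp_schwartz {m : ℂ → ℝ} (hm : Measurable m) {C : ℝ}
    (hC : ∀ ξ, |m ξ| ≤ C) (f : 𝓢(ℂ, ℂ)) : Continuous (multiplierOp (fun ξ => (m ξ : ℂ)) f) := by
  have hi : Integrable fun ξ => (m ξ : ℂ) * 𝓕 (f : ℂ → ℂ) ξ := by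
    refine (schwartz_fourier_integrable f).bdd_mul (c := C) ?_ (Eventually.of_forall fun ξ => ?_)
    · fun_prop
    · rw [norm_real]; exact hC _
  have : multiplierOp (fun ξ => (m ξ : ℂ)) f =
      fun z => ∫ ξ, planeChar z ξ * ((m ξ : ℂ) * 𝓕 (f : ℂ → ℂ) ξ) := by
    ext z; rw [multiplierOp, fourierInv_eq_integral_planeChar]
  rw [this]
  refine continuous_of_dominated (bound := fun ξ => ‖(m ξ : ℂ) * 𝓕 (f : ℂ → ℂ) ξ‖)
    (fun z => (integrable_planeChar_mul hi z).aestronglyMeasurable)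
    (fun z => Eventually.of_forall fun ξ => ?_) hi.norm (Eventually.of_forall fun ξ => ?_)
  · rw [norm_mul, norm_planeChar, one_mul]
  · simp only [planeChar_comm _ ξ]
    fun_prop

/-- The trigonometric polynomials on the torus whose frequencies all have last nonzero
coordinate `k`. -/
def topFreqSpan {n : ℕ} (k : Fin n) : Submodule ℂ C(UnitAddTorus (Fin n), ℂ) :=
  Submodule.span ℂ {f | ∃ j : Fin n → ℤ, j k ≠ 0 ∧ (∀ i, k < i → j i = 0) ∧
    f = UnitAddTorus.mFourier j}

/-- The windowed pull-back `ψ · Φ ∘ lacunaryMap` is a Schwartz function on which `m` acts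
asymptotically as multiplication by the value of `m` at `v k`. -/
lemma exists_schwartz_lacunary {n : ℕ} {v : Fin n → ℂ} {m : ℂ → ℝ}
    (hm : Measurable m) {C : ℝ} (hC : ∀ ξ, |m ξ| ≤ C) (hcont : ContinuousOn m {0}ᶜ)
    (hom : ∀ c : ℝ, c ≠ 0 → ∀ ξ : ℂ, m (c * ξ) = m ξ) (ψ : 𝓢(ℂ, ℂ)) (hψ : HasCompactSupport ψ)
    {k : Fin n} (hv : v k ≠ 0) {Φ : C(UnitAddTorus (Fin n), ℂ)} (hΦ : Φ ∈ topFreqSpan k) :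
    ∃ (f : ℕ → 𝓢(ℂ, ℂ)) (E : ℕ → ℝ), (∀ L z, f L z = ψ z * Φ (lacunaryMap v L z)) ∧
      Tendsto E atTop (𝓝 0) ∧ ∀ L z,
      ‖multiplierOp (fun ξ => (m ξ : ℂ)) (f L) z - m (v k) * f L z‖ ≤ E L := by
  induction hΦ using Submodule.span_induction with
  | mem Φ hΦ =>
    obtain ⟨j, hk, hj, rfl⟩ := hΦ
    obtain ⟨E, hE, hb⟩ := exists_bound_multiplierOp_mul_planeChar hm hC
      (tendsto_symbol_lacunaryFreq hcont hom hv hk hj) ψ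
    have hs : ∀ ω, ContDiff ℝ ((⊤ : ℕ∞) : WithTop ℕ∞) fun z => ψ z * planeChar ω z := by
      intro ω
      refine (ψ.smooth ⊤).mul ?_
      unfold planeChar
      exact Complex.contDiff_exp.comp ((ofRealCLM.contDiff.comp
        (contDiff_const.mul (innerSL ℝ ω).contDiff)).mul contDiff_const)
    have hcs : ∀ ω, HasCompactSupport fun z => ψ z * planeChar ω z := fun ω => hψ.mul_right
    refine ⟨fun L => (hcs (lacunaryFreq v L j)).toSchwartzMap (hs _), E, fun L z => ?_, hE, hb⟩
    rw [mFourier_lacunaryMap]; rfl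
  | zero =>
    refine ⟨fun _ => 0, fun _ => 0, by simp, tendsto_const_nhds, fun L z => ?_⟩
    have : ((0 : 𝓢(ℂ, ℂ)) : ℂ → ℂ) = fun z => 0 * (0 : ℂ → ℂ) z := by ext; simp
    rw [this, multiplierOp_smul]; simp
  | add Φ₁ Φ₂ _ _ h₁ h₂ =>
    obtain ⟨f₁, E₁, hf₁, hE₁, hb₁⟩ := h₁
    obtain ⟨f₂, E₂, hf₂, hE₂, hb₂⟩ := h₂
    refine ⟨fun L => f₁ L + f₂ L, fun L => E₁ L + E₂ L, fun L z => ?_, by simpa using hE₁.add hE₂,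
      fun L z => ?_⟩
    · rw [add_apply, hf₁, hf₂, ContinuousMap.add_apply]; ring
    · rw [multiplierOp_schwartz_add hm hC, add_apply, mul_add, add_sub_add_comm]
      exact (norm_add_le _ _).trans (add_le_add (hb₁ L z) (hb₂ L z))
  | smul c Φ _ h =>
    obtain ⟨f, E, hf, hE, hb⟩ := h
    refine ⟨fun L => c • f L, fun L => ‖c‖ * E L, fun L z => ?_, by simpa using hE.const_mul ‖c‖,
      fun L z => ?_⟩
    · rw [smul_apply, hf, ContinuousMap.smul_apply, smul_eq_mul, smul_eq_mul]; ring
    · have : ((c • f L : 𝓢(ℂ, ℂ)) : ℂ → ℂ) = fun z => c * f L z := rfl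
      rw [this, multiplierOp_smul, mul_left_comm, ← mul_sub, norm_mul]
      exact mul_le_mul_of_nonneg_left (hb L z) (norm_nonneg c)

lemma exists_schwartz_lacunary_sum {n : ℕ} {v : Fin n → ℂ} {m : ℂ → ℝ}
    (hm : Measurable m) {C : ℝ} (hC : ∀ ξ, |m ξ| ≤ C) (hcont : ContinuousOn m {0}ᶜ)
    (hom : ∀ c : ℝ, c ≠ 0 → ∀ ξ : ℂ, m (c * ξ) = m ξ) (ψ : 𝓢(ℂ, ℂ)) (hψ : HasCompactSupport ψ)
    (hv : ∀ i, v i ≠ 0) {φ : Fin n → C(UnitAddTorus (Fin n), ℂ)} (hφ : ∀ k, φ k ∈ topFreqSpan k) :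
    ∃ (f : ℕ → 𝓢(ℂ, ℂ)) (E : ℕ → ℝ), (∀ L z, f L z = ψ z * ∑ k, φ k (lacunaryMap v L z)) ∧
      Tendsto E atTop (𝓝 0) ∧ ∀ L z, ‖multiplierOp (fun ξ => (m ξ : ℂ)) (f L) z -
        ψ z * ∑ k, m (v k) * φ k (lacunaryMap v L z)‖ ≤ E L := by
  suffices H : ∀ s : Finset (Fin n), ∃ (f : ℕ → 𝓢(ℂ, ℂ)) (E : ℕ → ℝ),
      (∀ L z, f L z = ψ z * ∑ k ∈ s, φ k (lacunaryMap v L z)) ∧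
      Tendsto E atTop (𝓝 0) ∧ ∀ L z, ‖multiplierOp (fun ξ => (m ξ : ℂ)) (f L) z -
        ψ z * ∑ k ∈ s, m (v k) * φ k (lacunaryMap v L z)‖ ≤ E L from H Finset.univ
  classical
  intro s
  induction s using Finset.induction_on with
  | empty =>
    refine ⟨fun _ => 0, fun _ => 0, by simp, tendsto_const_nhds, fun L z => ?_⟩
    have : ((0 : 𝓢(ℂ, ℂ)) : ℂ → ℂ) = fun z => 0 * (0 : ℂ → ℂ) z := by ext; simp
    rw [this, multiplierOp_smul]; simp
  | insert k s hk h =>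
    obtain ⟨f₁, E₁, hf₁, hE₁, hb₁⟩ :=
      exists_schwartz_lacunary hm hC hcont hom ψ hψ (hv k) (hφ k)
    obtain ⟨f₂, E₂, hf₂, hE₂, hb₂⟩ := h
    refine ⟨fun L => f₁ L + f₂ L, fun L => E₁ L + E₂ L, fun L z => ?_, by simpa using hE₁.add hE₂,
      fun L z => ?_⟩
    · rw [add_apply, hf₁, hf₂, Finset.sum_insert hk]; ring
    · rw [multiplierOp_schwartz_add hm hC, Finset.sum_insert hk, mul_add, add_sub_add_comm]
      refine (norm_add_le _ _).trans (add_le_add ?_ (hb₂ L z))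
      have := hb₁ L z
      rwa [hf₁, mul_left_comm] at this

/-! ### The transference inequality -/

/-- The pair `(w, c w')` in the Hilbert space `ℂ²`. -/
def hilbertPair (τ : ℝ) (w w' : ℂ) : EuclideanSpace ℂ (Fin 2) := !₂[w, (τ : ℂ) * w']

lemma norm_hilbertPair (τ : ℝ) (w w' : ℂ) :
    ‖hilbertPair τ w w'‖ = √(‖w‖ ^ 2 + (|τ| * ‖w'‖) ^ 2) := by
  simp [hilbertPair, EuclideanSpace.norm_eq]

@[fun_prop]
lemma continuous_hilbertPair {X : Type*} [TopologicalSpace X] (τ : ℝ) {f g : X → ℂ}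
    (hf : Continuous f) (hg : Continuous g) : Continuous fun x => hilbertPair τ (f x) (g x) := by
  unfold hilbertPair
  refine (PiLp.continuous_toLp 2 _).comp (continuous_pi fun i => ?_)
  fin_cases i
  · simpa using hf
  · exact continuous_const.mul hg

lemma vectorMultiplierOp_eq_hilbertPair (m : ℂ → ℝ) (τ : ℝ) (f : 𝓢(ℂ, ℂ)) (z : ℂ) :
    vectorMultiplierOp ![fun ξ => (m ξ : ℂ), fun _ => (τ : ℂ)] f z =
      hilbertPair τ (multiplierOp (fun ξ => (m ξ : ℂ)) f z) (f z) := by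
  ext i
  fin_cases i
  · simp [vectorMultiplierOp, hilbertPair]
  · simp [vectorMultiplierOp, hilbertPair, multiplierOp_const]

/-- A zero denominator needs separate treatment: then `f` vanishes almost everywhere, and so do its
transform and the left side. -/
lemma eLpNorm_vectorMultiplierOp_le {n : ℕ} (M : Fin n → ℂ → ℂ) {p : ℝ} (hp : 0 < p)
    (f : 𝓢(ℂ, ℂ)) :
    eLpNorm (vectorMultiplierOp M f) (ENNReal.ofReal p) volume ≤
      vectorMultiplierNorm M p p * eLpNorm f (ENNReal.ofReal p) volume := by
  rcases eq_or_ne (eLpNorm f (ENNReal.ofReal p) volume) 0 with h0 | h0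
  · have hf := (eLpNorm_eq_zero_iff f.continuous.aestronglyMeasurable (by simpa using hp)).1 h0
    have hF : 𝓕 (f : ℂ → ℂ) = 0 := by
      ext ξ
      rw [Real.fourier_congr_ae hf, fourier_eq_integral_planeChar]
      simp
    have : vectorMultiplierOp M f = 0 := by
      ext z i
      simp [vectorMultiplierOp, multiplierOp, hF, fourierInv_eq_integral_planeChar]
    rw [this]; simp
  · have hmem : MemLp f (ENNReal.ofReal p) volume := f.memLp _ _
    rw [← ENNReal.div_le_iff h0 hmem.eLpNorm_ne_top]
    exact le_iSup (fun f : 𝓢(ℂ, ℂ) => eLpNorm (vectorMultiplierOp M f) (ENNReal.ofReal p) volume /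
      eLpNorm f (ENNReal.ofReal p) volume) f

section window
variable {n : ℕ} {v : Fin n → ℂ} {p : ℝ}
variable {E : Type*} [NormedAddCommGroup E] [NormedSpace ℂ E]

/-- The p-th power of the norm is the integral of ‖ψ‖^p times a continuous function of `lacunaryMap
v L z`, so equidistribution applies with density ‖ψ‖^p. -/
lemma tendsto_eLpNorm_window (hv : ∀ i, v i ≠ 0) (hp : 0 < p) {ψ : 𝓢(ℂ, ℂ)}
    (hψ : HasCompactSupport ψ) {Θ : UnitAddTorus (Fin n) → E} (hΘ : Continuous Θ) :
    Tendsto (fun L => eLpNorm (fun z => ψ z • Θ (lacunaryMap v L z)) (ENNReal.ofReal p) volume)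
      atTop (𝓝 (ENNReal.ofReal (((∫ z, ‖ψ z‖ ^ p) * ∫ t, ‖Θ t‖ ^ p ∂torusMeasure n) ^ p⁻¹))) := by
  have hψc := ψ.continuous
  have hcont : ∀ L, Continuous fun z => ψ z • Θ (lacunaryMap v L z) := fun L => by fun_prop
  have hcs : ∀ L, HasCompactSupport fun z => ψ z • Θ (lacunaryMap v L z) := fun L =>
    hψ.smul_right
  have heq : ∀ L, eLpNorm (fun z => ψ z • Θ (lacunaryMap v L z)) (ENNReal.ofReal p) volume =
      ENNReal.ofReal ((∫ z, ‖ψ z‖ ^ p * ‖Θ (lacunaryMap v L z)‖ ^ p) ^ p⁻¹) := fun L => by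
    rw [MemLp.eLpNorm_eq_integral_rpow_norm (by simpa using hp) (by simp)
      ((hcont L).memLp_of_hasCompactSupport (hcs L)), ENNReal.toReal_ofReal hp.le]
    congr 3; ext z
    rw [norm_smul, Real.mul_rpow (norm_nonneg _) (norm_nonneg _)]
  simp only [heq]
  refine (ENNReal.continuous_ofReal.tendsto _).comp ?_
  refine Tendsto.rpow_const ?_ (Or.inr (by positivity))
  have hgc : Continuous fun z => ‖ψ z‖ ^ p := hψc.norm.rpow_const fun _ => Or.inr hp.le
  have hgi : Integrable fun z => ‖ψ z‖ ^ p := by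
    refine hgc.integrable_of_hasCompactSupport ?_
    exact hψ.comp_left (g := fun w : ℂ => ‖w‖ ^ p) (by simp [Real.zero_rpow hp.ne'])
  let Φ : C(UnitAddTorus (Fin n), ℂ) := ⟨fun t => ((‖Θ t‖ ^ p : ℝ) : ℂ),
    continuous_ofReal.comp (hΘ.norm.rpow_const fun _ => Or.inr hp.le)⟩
  have h := tendsto_integral_lacunaryMap hv hgi.ofReal Φ
  have h' := (continuous_re.tendsto _).comp h
  have e1 : ∀ L, (∫ z, ((‖ψ z‖ ^ p : ℝ) : ℂ) * Φ (lacunaryMap v L z)) =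
      ((∫ z, ‖ψ z‖ ^ p * ‖Θ (lacunaryMap v L z)‖ ^ p : ℝ) : ℂ) := fun L => by
    refine Eq.trans ?_ (integral_ofReal (𝕜 := ℂ))
    congr 1; ext z
    simp [Φ]
  have e2 : (∫ z, ((‖ψ z‖ ^ p : ℝ) : ℂ)) = ((∫ z, ‖ψ z‖ ^ p : ℝ) : ℂ) := integral_ofReal
  have e3 : (∫ t, Φ t ∂torusMeasure n) = ((∫ t, ‖Θ t‖ ^ p ∂torusMeasure n : ℝ) : ℂ) :=
    integral_ofReal
  have e4 : ∀ x : ℝ, (RCLike.ofReal x : ℂ) = (x : ℂ) := fun _ => rfl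
  simp only [e4, e2, e3, ← ofReal_mul, ofReal_re] at h'
  refine h'.congr fun L => ?_
  simp only [Function.comp_apply]
  rw [e1, ofReal_re]

end window

lemma exists_window {p : ℝ} (hp : 0 < p) :
    ∃ ψ : 𝓢(ℂ, ℂ), HasCompactSupport ψ ∧ 0 < ∫ z, ‖ψ z‖ ^ p := by
  let b : ContDiffBump (0 : ℂ) := ⟨1, 2, one_pos, one_lt_two⟩
  have hc : HasCompactSupport fun z => (b z : ℂ) := b.hasCompactSupport.comp_left ofReal_zero
  have hs : ContDiff ℝ ((⊤ : ℕ∞) : WithTop ℕ∞) fun z => (b z : ℂ) :=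
    ofRealCLM.contDiff.comp b.contDiff
  refine ⟨hc.toSchwartzMap hs, hc, ?_⟩
  have hgc : Continuous fun z => ‖hc.toSchwartzMap hs z‖ ^ p :=
    (SchwartzMap.continuous _).norm.rpow_const fun _ => Or.inr hp.le
  refine hgc.integral_pos_of_hasCompactSupport_nonneg_nonzero (x := 0) ?_
    (fun z => by positivity) ?_
  · exact hc.comp_left (g := fun w : ℂ => ‖w‖ ^ p) (by simp [Real.zero_rpow hp.ne'])
  · have : b 0 = 1 := b.one_of_mem_closedBall (by simp [b])
    simp [this]

/-- Transference: on trigonometric polynomials of the torus that are split according to the last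
nonzero coordinate of the frequency, multiplying the parts by the values `m (v k)` is controlled
by the multiplier norm on the plane. -/
theorem torus_transference {n : ℕ} {v : Fin n → ℂ} {m : ℂ → ℝ} (hm : Measurable m) {C : ℝ}
    (hC : ∀ ξ, |m ξ| ≤ C) (hcont : ContinuousOn m {0}ᶜ)
    (hom : ∀ c : ℝ, c ≠ 0 → ∀ ξ : ℂ, m (c * ξ) = m ξ) (hv : ∀ i, v i ≠ 0)
    {φ : Fin n → C(UnitAddTorus (Fin n), ℂ)} (hφ : ∀ k, φ k ∈ topFreqSpan k)
    {p : ℝ} (hp : 1 < p) (τ : ℝ) {A : ℝ}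
    (hA : vectorMultiplierNorm ![fun ξ => (m ξ : ℂ), fun _ => (τ : ℂ)] p p ≤ ENNReal.ofReal A)
    (hA0 : 0 ≤ A) :
    ∫ t, ‖hilbertPair τ (∑ k, m (v k) * φ k t) (∑ k, φ k t)‖ ^ p ∂torusMeasure n ≤
      A ^ p * ∫ t, ‖∑ k, φ k t‖ ^ p ∂torusMeasure n := by
  have hp0 : 0 < p := one_pos.trans hp
  obtain ⟨ψ, hψ, hψp⟩ := exists_window hp0
  obtain ⟨f, E, hf, hE, hb⟩ := exists_schwartz_lacunary_sum hm hC hcont hom ψ hψ hv hφ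
  set Θ : UnitAddTorus (Fin n) → EuclideanSpace ℂ (Fin 2) := fun t =>
    hilbertPair τ (∑ k, m (v k) * φ k t) (∑ k, φ k t)
  set F : UnitAddTorus (Fin n) → ℂ := fun t => ∑ k, φ k t
  have hΘ : Continuous Θ := by fun_prop
  have hF : Continuous F := by fun_prop
  set K := tsupport ψ
  have hK : IsCompact K := hψ
  set T : ℕ → ℂ → EuclideanSpace ℂ (Fin 2) := fun L =>
    vectorMultiplierOp ![fun ξ => (m ξ : ℂ), fun _ => (τ : ℂ)] (f L)
  have hT : ∀ L, Continuous (T L) := fun L => by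
    have := continuous_multiplierOp_schwartz hm hC (f L)
    have h2 := (f L).continuous
    have : T L = fun z => hilbertPair τ (multiplierOp (fun ξ => (m ξ : ℂ)) (f L) z) (f L z) :=
      funext fun z => vectorMultiplierOp_eq_hilbertPair m τ (f L) z
    rw [this]; fun_prop
  have hψc := ψ.continuous
  -- `T L` need not be supported in `K`, but restricting it to `K` only lowers its norm. The error
  -- is merely uniform in z, so it is small in L^p because `K` has finite measure.
  have hmain : ∀ L, eLpNorm (fun z => ψ z • Θ (lacunaryMap v L z)) (ENNReal.ofReal p) volume ≤
      ENNReal.ofReal A *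
        eLpNorm (fun z => ψ z • F (lacunaryMap v L z)) (ENNReal.ofReal p) volume +
      volume K ^ p⁻¹ * ENNReal.ofReal (E L) := by
    intro L
    have hsupp : Function.support (fun z => ψ z • Θ (lacunaryMap v L z)) ⊆ K := fun z hz =>
      subset_tsupport _ (by
        simp only [Function.mem_support] at hz ⊢
        exact fun h => hz (by simp [h]))
    have hfF : (fun z => ψ z • F (lacunaryMap v L z)) = f L := by
      ext z; rw [hf, smul_eq_mul]
    have hdiff : ∀ z, ‖ψ z • Θ (lacunaryMap v L z) - T L z‖ ≤ E L := by
      intro z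
      have : ψ z • Θ (lacunaryMap v L z) - T L z = hilbertPair τ (ψ z *
          (∑ k, m (v k) * φ k (lacunaryMap v L z)) -
          multiplierOp (fun ξ => (m ξ : ℂ)) (f L) z) 0 := by
        simp only [T, vectorMultiplierOp_eq_hilbertPair, hf]
        ext i
        fin_cases i
        · simp [Θ, hilbertPair]
        · simp [Θ, hilbertPair]; ring
      rw [this, norm_hilbertPair, norm_zero, mul_zero, zero_pow two_ne_zero, add_zero,
        Real.sqrt_sq (norm_nonneg _), norm_sub_rev]
      exact hb L z
    calc _ = eLpNorm (fun z => ψ z • Θ (lacunaryMap v L z)) (ENNReal.ofReal p)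
          (volume.restrict K) := (eLpNorm_restrict_eq_of_support_subset hsupp).symm
      _ = eLpNorm (T L + fun z => ψ z • Θ (lacunaryMap v L z) - T L z) (ENNReal.ofReal p)
          (volume.restrict K) := by congr 1; ext1 z; simp
      _ ≤ eLpNorm (T L) (ENNReal.ofReal p) (volume.restrict K) +
          eLpNorm (fun z => ψ z • Θ (lacunaryMap v L z) - T L z) (ENNReal.ofReal p)
          (volume.restrict K) := by
        refine eLpNorm_add_le (hT L).aestronglyMeasurable ?_ (by simpa using hp.le)
        have := hT L
        exact Continuous.aestronglyMeasurable (by fun_prop)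
      _ ≤ _ := by
        refine add_le_add ?_ ?_
        · rw [hfF]
          refine (eLpNorm_mono_measure _ Measure.restrict_le_self).trans ?_
          exact (eLpNorm_vectorMultiplierOp_le _ hp0 (f L)).trans (by gcongr)
        · refine (eLpNorm_le_of_ae_bound (Eventually.of_forall hdiff)).trans (le_of_eq ?_)
          rw [Measure.restrict_apply_univ, ENNReal.toReal_ofReal hp0.le]
  have l1 := tendsto_eLpNorm_window hv hp0 hψ hΘ
  have l2 := (ENNReal.Tendsto.const_mul (tendsto_eLpNorm_window hv hp0 hψ hF)
    (Or.inr (ENNReal.ofReal_ne_top (r := A)))).add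
    (ENNReal.Tendsto.const_mul ((ENNReal.continuous_ofReal.tendsto _).comp hE)
      (Or.inr (ENNReal.rpow_ne_top_of_nonneg (inv_nonneg.2 hp0.le) (hK.measure_lt_top (μ := volume)).ne)))
  -- In the limit both norms contain the same window factor `J`, which cancels.
  have h := le_of_tendsto_of_tendsto' l1 l2 hmain
  set X := ∫ t, ‖Θ t‖ ^ p ∂torusMeasure n
  set Y := ∫ t, ‖F t‖ ^ p ∂torusMeasure n
  set J := ∫ z, ‖ψ z‖ ^ p
  have hX : 0 ≤ X := integral_nonneg fun t => by positivity
  have hY : 0 ≤ Y := integral_nonneg fun t => by positivity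
  rw [ENNReal.ofReal_zero, mul_zero, add_zero, ← ENNReal.ofReal_mul hA0,
    ENNReal.ofReal_le_ofReal_iff (by positivity)] at h
  have h2 := Real.rpow_le_rpow (by positivity) h hp0.le
  rw [Real.mul_rpow hA0 (by positivity), Real.rpow_inv_rpow (by positivity) hp0.ne',
    Real.rpow_inv_rpow (by positivity) hp0.ne'] at h2
  refine le_of_mul_le_mul_left ?_ hψp
  linarith

/-! ### From the torus to random signs -/

/-- The function `sin (2 π t)` on the circle `ℝ / ℤ`. -/
def circleSin (t : UnitAddCircle) : ℝ := (fourier 1 t : ℂ).im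

@[fun_prop]
lemma continuous_circleSin : Continuous circleSin := by unfold circleSin; fun_prop

lemma fourier_apply_neg (j : ℤ) (t : UnitAddCircle) :
    (fourier j (-t) : ℂ) = fourier (-j) t := by
  simp [fourier_apply]

lemma circleSin_neg (t : UnitAddCircle) : circleSin (-t) = -circleSin t := by
  rw [circleSin, fourier_apply_neg, fourier_neg, conj_im, circleSin]

/-- By invariance all points have equal mass, and a positive one would give the infinite circle
infinite measure. -/
lemma haarAddCircle_singleton (t : UnitAddCircle) :
    (AddCircle.haarAddCircle (T := (1 : ℝ))) {t} = 0 := by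
  rw [Measure.addHaar_singleton]
  by_contra h
  have : Infinite UnitAddCircle := by
    have : Infinite (Set.Ioc (0 : ℝ) (0 + 1)) := (Set.Ioc_infinite (by norm_num)).to_subtype
    exact Infinite.of_injective _ (AddCircle.equivIoc (1 : ℝ) 0).symm.injective
  have h1 := Set.infinite_univ.meas_eq_top (μ := AddCircle.haarAddCircle (T := (1 : ℝ)))
    ⟨_, h, fun x _ => (Measure.addHaar_singleton _ x).ge⟩
  rw [measure_univ] at h1
  exact ENNReal.one_ne_top h1

/-- Where the sine vanishes the injective character t ↦ exp(2πit) is real and unimodular, hence ±1;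
there are finitely many such t. -/
lemma haar_circleSin_eq_zero : AddCircle.haarAddCircle {t | circleSin t = 0} = 0 := by
  have hfin : {t : UnitAddCircle | circleSin t = 0}.Finite := by
    have hinj : Function.Injective fun t : UnitAddCircle => (fourier 1 t : ℂ) := by
      intro a b h
      simp only [fourier_one] at h
      exact AddCircle.injective_toCircle one_ne_zero (Subtype.coe_injective h)
    refine (Set.Finite.preimage hinj.injOn (Set.toFinite {(1 : ℂ), -1})).subset fun t ht => ?_
    have him : (fourier 1 t : ℂ).im = 0 := ht
    have hn : ‖(fourier 1 t : ℂ)‖ = 1 := Circle.norm_coe _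
    have hre := normSq_apply (fourier 1 t : ℂ)
    rw [normSq_eq_norm_sq, hn, him] at hre
    have h1 : (fourier 1 t : ℂ).re = 1 ∨ (fourier 1 t : ℂ).re = -1 :=
      mul_self_eq_one_iff.1 (by linarith)
    rcases h1 with h1 | h1
    · left; exact Complex.ext h1 him
    · right; exact Complex.ext h1 (by simpa using him)
  have : NullSingletonClass (AddCircle.haarAddCircle (T := (1 : ℝ))) := ⟨haarAddCircle_singleton⟩
  exact hfin.measure_zero _

/-- The square wave, with values in the group of signs. -/
def circleSign (t : UnitAddCircle) : ℤˣ := if 0 < circleSin t then 1 else -1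

lemma measurableSet_circleSign (b : ℤˣ) : MeasurableSet {t | circleSign t = b} := by
  have h : MeasurableSet {t | 0 < circleSin t} :=
    measurableSet_lt measurable_const continuous_circleSin.measurable
  rcases Int.units_eq_one_or b with rfl | rfl
  · convert h using 1
    ext t
    simp only [circleSign, Set.mem_ofPred_eq]
    split_ifs with h <;> simp [h]
  · convert h.compl using 1
    ext t
    simp only [circleSign, Set.mem_ofPred_eq, Set.mem_compl_iff]
    split_ifs with h <;> simp [h]

/-- The reflection t ↦ -t exchanges the two level sets up to a null set, and together they have mass
1. -/
lemma haar_circleSign (b : ℤˣ) : AddCircle.haarAddCircle {t | circleSign t = b} = 2⁻¹ := by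
  have hneg : AddCircle.haarAddCircle {t | circleSin t < 0} =
      AddCircle.haarAddCircle {t | 0 < circleSin t} := by
    rw [← Measure.measure_preimage_neg]
    congr 1; ext t
    simp [circleSin_neg]
  have h1 : {t | circleSign t = 1} = {t | 0 < circleSin t} := by
    ext t
    simp only [circleSign, Set.mem_ofPred_eq]
    split_ifs with h <;> simp [h]
  have h2 : AddCircle.haarAddCircle {t | circleSign t = -1} =
      AddCircle.haarAddCircle {t | 0 < circleSin t} := by
    rw [← hneg]
    refine measure_congr ?_
    have : ∀ᵐ t ∂(AddCircle.haarAddCircle (T := 1)), circleSin t ≠ 0 := by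
      rw [ae_iff]; simpa using haar_circleSin_eq_zero
    filter_upwards [this] with t ht
    refine propext ?_
    change circleSign t = -1 ↔ circleSin t < 0
    simp only [circleSign]
    split_ifs with h
    · simp [h.le]
    · simpa using lt_of_le_of_ne (not_lt.1 h) ht
  have h3 : AddCircle.haarAddCircle {t | circleSign t = 1} +
      AddCircle.haarAddCircle {t | circleSign t = -1} = 1 := by
    rw [← measure_union _ (measurableSet_circleSign _), ← measure_univ (μ := AddCircle.haarAddCircle (T := 1))]
    · congr 1
      ext t
      simpa using Int.units_eq_one_or (circleSign t)
    · rw [Set.disjoint_left]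
      intro t (ht : _ = _) (ht' : _ = _)
      rw [ht] at ht'; exact absurd ht' (by decide)
  rw [h1, h2, ← two_mul] at h3
  have h4 := ENNReal.eq_inv_of_mul_eq_one_left ((mul_comm _ _).trans h3)
  rcases Int.units_eq_one_or b with rfl | rfl
  · rw [h1, h4]
  · rw [h2, h4]

/-- Independent square waves are independent fair signs. -/
lemma integral_comp_circleSign {n : ℕ} (h : (Fin n → ℤˣ) → ℝ) :
    ∫ t, h (fun i => circleSign (t i)) ∂torusMeasure n = (∑ r, h r) / 2 ^ n := by
  classical
  set B : (Fin n → ℤˣ) → Set (UnitAddTorus (Fin n)) := fun r =>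
    Set.univ.pi fun i => {t | circleSign t = r i}
  have hB : ∀ r, MeasurableSet (B r) := fun r =>
    MeasurableSet.univ_pi fun i => measurableSet_circleSign (r i)
  have hμ : ∀ r, (torusMeasure n).real (B r) = (2 ^ n)⁻¹ := fun r => by
    rw [measureReal_def, torusMeasure, Measure.pi_pi]
    simp [haar_circleSign]
  have e : ∀ t : UnitAddTorus (Fin n), h (fun i => circleSign (t i)) =
      ∑ r, (B r).indicator (fun _ => h r) t := by
    intro t
    rw [Finset.sum_eq_single (fun i => circleSign (t i))]
    · rw [Set.indicator_of_mem]; simp [B]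
    · intro r _ hr
      rw [Set.indicator_of_notMem]
      intro hm
      exact hr (funext fun i => (hm i (Set.mem_univ i)).symm)
    · simp
  simp only [e]
  rw [integral_finsetSum _ fun r _ => (integrable_const _).indicator (hB r)]
  simp only [integral_indicator_const _ (hB _), hμ, smul_eq_mul]
  rw [← Finset.mul_sum]; ring

/-- The trigonometric polynomials on the circle with vanishing mean. -/
def meanZeroSpan : Submodule ℂ C(UnitAddCircle, ℂ) :=
  Submodule.span ℂ {f | ∃ j : ℤ, j ≠ 0 ∧ f = fourier j}

/-- Taking the odd part cancels the constant term. -/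
lemma sub_comp_neg_mem_meanZeroSpan {Q : C(UnitAddCircle, ℂ)}
    (hQ : Q ∈ Submodule.span ℂ (Set.range (fourier (T := 1)))) :
    Q - Q.comp ⟨fun t => -t, continuous_neg⟩ ∈ meanZeroSpan := by
  induction hQ using Submodule.span_induction with
  | mem x hx =>
    obtain ⟨j, rfl⟩ := hx
    have : (fourier j).comp ⟨fun t => -t, continuous_neg⟩ = fourier (T := (1 : ℝ)) (-j) := by
      ext t; exact fourier_apply_neg j t
    rw [this]
    rcases eq_or_ne j 0 with rfl | hj
    · simp
    · exact sub_mem (Submodule.subset_span ⟨j, hj, rfl⟩)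
        (Submodule.subset_span ⟨-j, neg_ne_zero.2 hj, rfl⟩)
  | zero => simp
  | add x y _ _ hx hy => simpa [add_sub_add_comm] using add_mem hx hy
  | smul c x _ hx => simpa [smul_sub] using Submodule.smul_mem _ c hx

/-- The square wave is a bounded pointwise limit of trigonometric polynomials of mean zero. -/
lemma exists_meanZero_tendsto_circleSign :
    ∃ q : ℕ → C(UnitAddCircle, ℂ), (∀ l, q l ∈ meanZeroSpan) ∧ (∀ l t, ‖q l t‖ ≤ 2) ∧
      ∀ t, circleSin t ≠ 0 → Tendsto (fun l => q l t) atTop (𝓝 (((circleSign t : ℤ) : ℂ))) := by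
  -- Clamping l · sin to [-1, 1] gives continuous odd approximations that are eventually exact
  -- wherever the sine is nonzero.
  set g : ℕ → UnitAddCircle → ℝ := fun l t => max (-1) (min 1 (l * circleSin t))
  have hgneg : ∀ l t, g l (-t) = -g l t := fun l t => by
    simp only [g, circleSin_neg, mul_neg]
    simp only [max_def, min_def]
    split_ifs <;> linarith
  have hg1 : ∀ l t, |g l t| ≤ 1 := fun l t =>
    abs_le.2 ⟨le_max_left _ _, max_le (by norm_num) (min_le_left _ _)⟩
  have hQ : ∀ l : ℕ, ∃ Q ∈ Submodule.span ℂ (Set.range (fourier (T := 1))),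
      ∀ t, ‖(g l t : ℂ) - Q t‖ ≤ 1 / ((l : ℝ) + 1) := by
    intro l
    let G : C(UnitAddCircle, ℂ) := ⟨fun t => (g l t : ℂ), by fun_prop⟩
    have hcl : G ∈ closure (Submodule.span ℂ (Set.range (fourier (T := 1))) :
        Set C(UnitAddCircle, ℂ)) := by
      rw [← Submodule.topologicalClosure_coe, span_fourier_closure_eq_top]
      trivial
    obtain ⟨Q, hQ, hd⟩ := Metric.mem_closure_iff.1 hcl (1 / ((l : ℝ) + 1)) (by positivity)
    rw [dist_eq_norm] at hd
    exact ⟨Q, hQ, fun t => ((G - Q).norm_coe_le_norm t).trans hd.le⟩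
  choose Q hQs hQd using hQ
  -- Passing to the odd part removes the mean and, `g l` being odd, does not worsen the
  -- approximation.
  set q : ℕ → C(UnitAddCircle, ℂ) := fun l =>
    (2⁻¹ : ℂ) • (Q l - (Q l).comp ⟨fun t => -t, continuous_neg⟩)
  have hqd : ∀ l t, ‖(g l t : ℂ) - q l t‖ ≤ 1 / ((l : ℝ) + 1) := by
    intro l t
    have e : (g l t : ℂ) - q l t =
        (((g l t : ℂ) - Q l t) - ((g l (-t) : ℂ) - Q l (-t))) / 2 := by
      rw [hgneg]
      simp [q]; ring
    rw [e, norm_div]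
    have := (norm_sub_le ((g l t : ℂ) - Q l t) ((g l (-t) : ℂ) - Q l (-t))).trans
      (add_le_add (hQd l t) (hQd l (-t)))
    simp only [Complex.norm_ofNat]
    linarith
  refine ⟨q, fun l => Submodule.smul_mem _ _ (sub_comp_neg_mem_meanZeroSpan (hQs l)),
    fun l t => ?_, fun t ht => ?_⟩
  · have h1 : (1 : ℝ) / (l + 1) ≤ 1 := by
      rw [div_le_one (by positivity)]; linarith [Nat.cast_nonneg (α := ℝ) l]
    have h2 : ‖(g l t : ℂ)‖ ≤ 1 := by rw [norm_real]; exact hg1 l t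
    calc ‖q l t‖ = ‖(g l t : ℂ) - ((g l t : ℂ) - q l t)‖ := by congr 1; ring
      _ ≤ 2 := by linarith [norm_sub_le (g l t : ℂ) ((g l t : ℂ) - q l t), hqd l t]
  · have hlim : Tendsto (fun l => (g l t : ℂ)) atTop (𝓝 (((circleSign t : ℤ) : ℂ))) := by
      refine tendsto_const_nhds.congr' ?_
      obtain ⟨M, hM⟩ := exists_nat_ge (1 / |circleSin t|)
      filter_upwards [eventually_ge_atTop M] with l hl
      have h0 : 1 ≤ l * |circleSin t| := by
        rw [div_le_iff₀ (abs_pos.2 ht)] at hM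
        exact hM.trans (by gcongr)
      rcases lt_or_gt_of_ne ht with h | h
      · rw [abs_of_neg h] at h0
        have : g l t = -1 := by
          simp only [g]
          rw [min_eq_right (by linarith), max_eq_left (by linarith)]
        rw [this, circleSign, if_neg (not_lt.2 h.le)]; simp
      · rw [abs_of_pos h] at h0
        have : g l t = 1 := by
          simp only [g]
          rw [min_eq_left (by linarith), max_eq_right (by norm_num)]
        rw [this, circleSign, if_pos h]; simp
    have hz : Tendsto (fun l => (g l t : ℂ) - q l t) atTop (𝓝 0) :=
      squeeze_zero_norm (fun l => hqd l t) tendsto_one_div_add_atTop_nhds_zero_nat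
    simpa using hlim.sub hz

/-- Dominated convergence: all arguments stay in the polydisc of radius 2, where Ψ is bounded. -/
lemma tendsto_integral_comp_signs {q : ℕ → C(UnitAddCircle, ℂ)} (hb : ∀ l t, ‖q l t‖ ≤ 2)
    (hq : ∀ t, circleSin t ≠ 0 → Tendsto (fun l => q l t) atTop (𝓝 (((circleSign t : ℤ) : ℂ))))
    {n : ℕ} {Ψ : (Fin n → ℂ) → ℝ} (hΨ : Continuous Ψ) :
    Tendsto (fun l => ∫ t, Ψ (fun i => q l (t i)) ∂torusMeasure n) atTop
      (𝓝 ((∑ r : Fin n → ℤˣ, Ψ (fun i => ((r i : ℤ) : ℂ))) / 2 ^ n)) := by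
  rw [← integral_comp_circleSign fun r => Ψ (fun i => ((r i : ℤ) : ℂ))]
  obtain ⟨C, hC⟩ := (isCompact_closedBall (0 : Fin n → ℂ) 2).exists_bound_of_continuousOn
    hΨ.continuousOn
  refine tendsto_integral_of_dominated_convergence (fun _ => C) (fun l => ?_) (integrable_const C)
    (fun l => Eventually.of_forall fun t => hC _ ?_) ?_
  · exact Continuous.aestronglyMeasurable (by fun_prop)
  · rw [mem_closedBall_zero_iff, pi_norm_le_iff_of_nonneg zero_le_two]
    exact fun i => hb l _
  · have : ∀ᵐ t ∂torusMeasure n, ∀ i, circleSin (t i) ≠ 0 := by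
      rw [ae_all_iff]
      intro i
      have h0 : ∀ᵐ t ∂(AddCircle.haarAddCircle (T := 1)), circleSin t ≠ 0 := by
        rw [ae_iff]; simpa using haar_circleSin_eq_zero
      exact (Measure.quasiMeasurePreserving_eval
        (fun _ : Fin n => AddCircle.haarAddCircle (T := 1)) i).ae h0
    filter_upwards [this] with t ht
    exact (hΨ.tendsto _).comp (tendsto_pi_nhds.2 fun i => hq _ (ht i))

/-! ### Martingale differences as trigonometric polynomials -/

/-- The pull-back of a function on the circle under the `i`-th coordinate of the torus. -/
def coordPull {n : ℕ} (i : Fin n) (q : C(UnitAddCircle, ℂ)) : C(UnitAddTorus (Fin n), ℂ) :=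
  ⟨fun t => q (t i), by fun_prop⟩

lemma coordPull_fourier_mul_mFourier {n : ℕ} (i : Fin n) (l : ℤ) (j : Fin n → ℤ) :
    coordPull i (fourier l) * UnitAddTorus.mFourier j =
      UnitAddTorus.mFourier (Pi.single i l + j) := by
  ext t
  rw [ContinuousMap.mul_apply, UnitAddTorus.mFourier_add]
  congr 1
  simp only [coordPull, UnitAddTorus.mFourier, ContinuousMap.coe_mk]
  rw [Finset.prod_eq_single i]
  · simp
  · intro b _ hb; simp [Pi.single_eq_of_ne hb]
  · simp

lemma coordPull_mem_topFreqSpan {n : ℕ} (k : Fin n) {q : C(UnitAddCircle, ℂ)}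
    (hq : q ∈ meanZeroSpan) : coordPull k q ∈ topFreqSpan k := by
  induction hq using Submodule.span_induction with
  | mem x hx =>
    obtain ⟨l, hl, rfl⟩ := hx
    refine Submodule.subset_span ⟨Pi.single k l + 0, by simpa using hl, fun i hi => ?_, ?_⟩
    · simp [Pi.single_eq_of_ne hi.ne']
    · rw [← coordPull_fourier_mul_mFourier, UnitAddTorus.mFourier_zero, mul_one]
  | zero => exact zero_mem _
  | add x y _ _ hx hy => exact add_mem hx hy
  | smul c x _ hx => exact Submodule.smul_mem _ c hx

/-- The algebra of trigonometric polynomials depending on the coordinates before `k` only. -/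
def pastAlgebra {n : ℕ} (k : Fin n) : Subalgebra ℂ C(UnitAddTorus (Fin n), ℂ) :=
  Algebra.adjoin ℂ {f | ∃ i < k, ∃ l : ℤ, f = coordPull i (fourier l)}

lemma coordPull_mem_pastAlgebra {n : ℕ} {i k : Fin n} (hi : i < k) {q : C(UnitAddCircle, ℂ)}
    (hq : q ∈ meanZeroSpan) : coordPull i q ∈ pastAlgebra k := by
  induction hq using Submodule.span_induction with
  | mem x hx =>
    obtain ⟨l, -, rfl⟩ := hx
    exact Algebra.subset_adjoin ⟨i, hi, l, rfl⟩
  | zero => exact zero_mem (pastAlgebra k)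
  | add x y _ _ hx hy => exact add_mem hx hy
  | smul c x _ hx => exact Subalgebra.smul_mem _ hx c

/-- Factors in the coordinates before `k` alter only the frequencies before `k`, so the last nonzero
index stays `k`. -/
lemma pastAlgebra_mul_mem_topFreqSpan {n : ℕ} {k : Fin n} {D E : C(UnitAddTorus (Fin n), ℂ)}
    (hD : D ∈ pastAlgebra k) (hE : E ∈ topFreqSpan k) : D * E ∈ topFreqSpan k := by
  induction hD using Algebra.adjoin_induction generalizing E with
  | mem x hx =>
    obtain ⟨i, hi, l, rfl⟩ := hx
    induction hE using Submodule.span_induction with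
    | mem y hy =>
      obtain ⟨j, hk, hj, rfl⟩ := hy
      rw [coordPull_fourier_mul_mFourier]
      refine Submodule.subset_span ⟨_, ?_, fun i' hi' => ?_, rfl⟩
      · simpa [Pi.single_eq_of_ne hi.ne'] using hk
      · simp [Pi.single_eq_of_ne (hi.trans hi').ne', hj i' hi']
    | zero => simp
    | add y z _ _ hy hz => rw [mul_add]; exact add_mem hy hz
    | smul c y _ hy => rw [mul_smul_comm]; exact Submodule.smul_mem _ c hy
  | algebraMap c =>
    rw [← Algebra.smul_def]; exact Submodule.smul_mem _ c hE
  | add x y _ _ hx hy => rw [add_mul]; exact add_mem (hx hE) (hy hE)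
  | mul x y _ _ hx hy => rw [mul_assoc]; exact hx (hy hE)

/-- The multilinear extension of a function of signs. -/
def multilinearExt {k : ℕ} (d : (Fin k → ℤˣ) → ℂ) (x : Fin k → ℂ) : ℂ :=
  ∑ s, d s * ∏ i, (2⁻¹ * (1 + ((s i : ℤ) : ℂ) * x i))

/-- This is interpolation on the cube: at a vertex every product but one contains a zero factor. The
extension is needed because approximate signs leave {±1}. -/
lemma multilinearExt_signs {k : ℕ} (d : (Fin k → ℤˣ) → ℂ) (r : Fin k → ℤˣ) :
    multilinearExt d (fun i => ((r i : ℤ) : ℂ)) = d r := by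
  rw [multilinearExt, Finset.sum_eq_single r]
  · rw [Finset.prod_eq_one, mul_one]
    intro i _
    rcases Int.units_eq_one_or (r i) with h | h <;> rw [h] <;> norm_num
  · intro s _ hs
    obtain ⟨i, hi⟩ := Function.ne_iff.1 hs
    rw [Finset.prod_eq_zero (Finset.mem_univ i), mul_zero]
    rcases Int.units_eq_one_or (r i) with h | h <;>
      rcases Int.units_eq_one_or (s i) with h' | h' <;> rw [h, h'] <;> simp_all
  · simp

@[fun_prop]
lemma continuous_multilinearExt {k : ℕ} (d : (Fin k → ℤˣ) → ℂ) :
    Continuous (multilinearExt d) := by unfold multilinearExt; fun_prop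

section martingale
variable {N : ℕ} (d : ∀ k : Fin N, (Fin (k.val + 1) → ℤˣ) → ℂ)

/-- The `k`-th term of the multilinear extension of a martingale. -/
def martingaleTerm (k : Fin N) (x : Fin (N + 1) → ℂ) : ℂ :=
  multilinearExt (d k) (fun i => x (Fin.castLE (Nat.succ_le_succ k.isLt.le) i)) * x k.succ

@[fun_prop]
lemma continuous_martingaleTerm (k : Fin N) : Continuous (martingaleTerm d k) := by
  unfold martingaleTerm; fun_prop

lemma martingaleTransform_eq_sum (β : Fin N → ℤˣ) (r : Fin (N + 1) → ℤˣ) :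
    martingaleTransform β d r =
      ∑ k, ((β k : ℤ) : ℂ) * martingaleTerm d k (fun i => ((r i : ℤ) : ℂ)) := by
  simp only [martingaleTransform, martingaleTerm]
  refine Finset.sum_congr rfl fun k _ => ?_
  rw [multilinearExt_signs (d k) (fun i => r (Fin.castLE (Nat.succ_le_succ k.isLt.le) i)),
    mul_assoc]

/-- The martingale differences transplanted to the torus by a function on the circle. -/
def torusDifference (q : C(UnitAddCircle, ℂ)) (k : Fin N) : C(UnitAddTorus (Fin (N + 1)), ℂ) :=
  (∑ s, d k s • ∏ i, ((2⁻¹ : ℂ) • (1 + ((s i : ℤ) : ℂ) •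
    coordPull (Fin.castLE (Nat.succ_le_succ k.isLt.le) i) q))) * coordPull k.succ q

lemma torusDifference_apply (q : C(UnitAddCircle, ℂ)) (k : Fin N)
    (t : UnitAddTorus (Fin (N + 1))) :
    torusDifference d q k t = martingaleTerm d k (fun i => q (t i)) := by
  simp [torusDifference, martingaleTerm, multilinearExt, coordPull, mul_add]

/-- The coefficient uses only the coordinates up to `k`, and the coordinate `k.succ` enters through
a factor of mean zero. This predictability is what the last-index splitting encodes. -/
lemma torusDifference_mem {q : C(UnitAddCircle, ℂ)} (hq : q ∈ meanZeroSpan) (k : Fin N) :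
    torusDifference d q k ∈ topFreqSpan k.succ := by
  refine pastAlgebra_mul_mem_topFreqSpan ?_ (coordPull_mem_topFreqSpan _ hq)
  refine Subalgebra.sum_mem _ fun s _ =>
    Subalgebra.smul_mem _ (Subalgebra.prod_mem _ fun i _ => ?_) _
  refine Subalgebra.smul_mem _ (add_mem (one_mem _) (Subalgebra.smul_mem _ ?_ _)) _
  refine coordPull_mem_pastAlgebra ?_ hq
  rw [Fin.lt_def]
  simp only [Fin.val_castLE, Fin.val_succ]
  exact i.isLt

end martingale

/-- The `L^p` estimate for sign transforms of Paley–Walsh martingales that follows from a bound for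
the multiplier norm. -/
theorem martingale_transference {m : ℂ → ℝ} (hm : Measurable m) {C : ℝ}
    (hC : ∀ ξ, |m ξ| ≤ C) (hcont : ContinuousOn m {0}ᶜ)
    (hom : ∀ c : ℝ, c ≠ 0 → ∀ ξ : ℂ, m (c * ξ) = m ξ)
    (hu : ∀ b : ℤˣ, ∃ u : ℂ, ‖u‖ = 1 ∧ m u = ((b : ℤ) : ℝ))
    {p : ℝ} (hp : 1 < p) (τ : ℝ) {A : ℝ}
    (hA : vectorMultiplierNorm ![fun ξ => (m ξ : ℂ), fun _ => (τ : ℂ)] p p ≤ ENNReal.ofReal A)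
    (hA0 : 0 ≤ A) {N : ℕ} (β : Fin N → ℤˣ) (d : ∀ k : Fin N, (Fin (k.val + 1) → ℤˣ) → ℂ) :
    ∑ r, ‖hilbertPair τ (martingaleTransform β d r) (martingaleTransform 1 d r)‖ ^ p ≤
      A ^ p * ∑ r, ‖martingaleTransform 1 d r‖ ^ p := by
  have hp0 : 0 < p := one_pos.trans hp
  choose u hu1 hum using hu
  have hu0 : ∀ b, u b ≠ 0 := fun b h => by simpa [h] using hu1 b
  obtain ⟨q, hqm, hqb, hq⟩ := exists_meanZero_tendsto_circleSign
  have key : ∀ l, ∫ t, ‖hilbertPair τ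
        (∑ k, ((β k : ℤ) : ℂ) * martingaleTerm d k (fun i => q l (t i)))
        (∑ k, martingaleTerm d k (fun i => q l (t i)))‖ ^ p ∂torusMeasure (N + 1) ≤
      A ^ p * ∫ t, ‖∑ k, martingaleTerm d k (fun i => q l (t i))‖ ^ p ∂torusMeasure (N + 1) := by
    intro l
    -- The direction attached to coordinate `k.succ` is one where m equals `β k`. Coordinate 0
    -- carries no difference, so its direction is arbitrary.
    have h := torus_transference hm hC hcont hom (n := N + 1)
      (v := Fin.cons (u 1) (fun k => u (β k)))
      (fun i => by refine Fin.cases ?_ (fun k => ?_) i <;> simp [hu0])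
      (φ := Fin.cons 0 (torusDifference d (q l)))
      (fun i => by
        refine Fin.cases ?_ (fun k => ?_) i
        · simp
        · simpa using torusDifference_mem d (hqm l) k) hp τ hA hA0
    simpa [Fin.sum_univ_succ, torusDifference_apply, hum] using h
  have c1 : Continuous fun x : Fin (N + 1) → ℂ => ‖hilbertPair τ
      (∑ k, ((β k : ℤ) : ℂ) * martingaleTerm d k x) (∑ k, martingaleTerm d k x)‖ ^ p :=
    Continuous.rpow_const (by fun_prop) fun _ => Or.inr hp0.le
  have c2 : Continuous fun x : Fin (N + 1) → ℂ => ‖∑ k, martingaleTerm d k x‖ ^ p :=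
    Continuous.rpow_const (by fun_prop) fun _ => Or.inr hp0.le
  have h := le_of_tendsto_of_tendsto' (tendsto_integral_comp_signs hqb hq c1)
    ((tendsto_integral_comp_signs hqb hq c2).const_mul (A ^ p)) key
  rw [← mul_div_assoc, div_le_div_iff_of_pos_right (by positivity)] at h
  have e : ∀ r, martingaleTransform 1 d r =
      ∑ k, martingaleTerm d k (fun i => ((r i : ℤ) : ℂ)) := fun r => by
    rw [martingaleTransform_eq_sum]; simp
  simp only [e, martingaleTransform_eq_sum d β]
  exact h

/-! ### Zigzag martingales and a Bellman function -/

/-- `Reach V l x y v`: there is a Paley–Walsh martingale started at `(x, y)`, whose successive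
increments point in the directions `(1, b)` for `b` in `l`, at whose terminal value `V` has
expectation `v`. -/
inductive Reach (V : ℝ → ℝ → ℝ) : List ℤˣ → ℝ → ℝ → ℝ → Prop
  | nil (x y : ℝ) : Reach V [] x y (V x y)
  | cons (b : ℤˣ) (l : List ℤˣ) (x y δ v₁ v₂ : ℝ) :
      Reach V l (x + δ) (y + ((b : ℤ) : ℝ) * δ) v₁ → Reach V l (x - δ) (y - ((b : ℤ) : ℝ) * δ) v₂ →
      Reach V (b :: l) x y ((v₁ + v₂) / 2)

namespace Reach
variable {V : ℝ → ℝ → ℝ} {l l₁ l₂ : List ℤˣ} {x y v v₁ v₂ : ℝ}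

lemma pad (b : ℤˣ) (h : Reach V l x y v) : Reach V (b :: l) x y v := by
  have := Reach.cons b l x y 0 v v (by simpa using h) (by simpa using h)
  simpa using this

/-- Both branches of a step must use the same signs, because the β_k do not depend on the outcome.
Zero increments pad each branch to a common list. -/
lemma of_sublist (hs : l₁.Sublist l₂) (h : Reach V l₁ x y v) : Reach V l₂ x y v := by
  induction hs generalizing x y v with
  | slnil => exact h
  | cons b _ ih => exact (ih h).pad b
  | cons_cons b _ ih =>
    cases h with
    | cons _ _ _ _ δ v₁ v₂ h₁ h₂ => exact Reach.cons _ _ _ _ δ _ _ (ih h₁) (ih h₂)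

lemma step (b : ℤˣ) (δ : ℝ) (h₁ : Reach V l₁ (x + δ) (y + ((b : ℤ) : ℝ) * δ) v₁)
    (h₂ : Reach V l₂ (x - δ) (y - ((b : ℤ) : ℝ) * δ) v₂) :
    Reach V (b :: (l₁ ++ l₂)) x y ((v₁ + v₂) / 2) :=
  Reach.cons _ _ _ _ δ _ _ (h₁.of_sublist (List.sublist_append_left _ _))
    (h₂.of_sublist (List.sublist_append_right _ _))

lemma scale {c s : ℝ} (hV : ∀ x y, V (c * x) (c * y) = s * V x y) (h : Reach V l x y v) :
    Reach V l (c * x) (c * y) (s * v) := by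
  induction h with
  | nil x y => rw [← hV]; exact Reach.nil _ _
  | cons b l x y δ v₁ v₂ _ _ ih₁ ih₂ =>
    have := Reach.cons b l (c * x) (c * y) (c * δ) (s * v₁) (s * v₂)
      (by convert ih₁ using 1 <;> ring) (by convert ih₂ using 1 <;> ring)
    convert this using 1; ring

end Reach

/-! ### Realising zigzags by sign martingales -/

/-- Two martingales, one of which is followed according to the outcome of an initial step. -/
lemma exists_joined_martingale {N : ℕ} (δ : ℂ) (d₁ d₂ : ∀ k : Fin N, (Fin (k.val + 1) → ℤˣ) → ℂ) :
    ∃ d : ∀ k : Fin (N + 1), (Fin (k.val + 1) → ℤˣ) → ℂ, ∀ (b : ℤˣ) (β : Fin N → ℤˣ)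
      (r : Fin (N + 2) → ℤˣ), martingaleTransform (Fin.cons b β : Fin (N + 1) → ℤˣ) d r =
        ((b : ℤ) : ℂ) * δ * ((r 1 : ℤ) : ℂ) +
          if r 1 = 1 then martingaleTransform β d₁ (fun i => r ((1 : Fin (N + 2)).succAbove i))
          else martingaleTransform β d₂ (fun i => r ((1 : Fin (N + 2)).succAbove i)) := by
  -- The new sign is inserted at index 1, since the first increment multiplies `r 1` and none
  -- multiplies `r 0`; `succAbove` skips it in the continuations.
  refine ⟨Fin.cases (motive := fun k : Fin (N + 1) => (Fin (k.val + 1) → ℤˣ) → ℂ) (fun _ => δ)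
    (fun k ρ => if ρ (1 : Fin (k.val + 2)) = 1 then
      d₁ k (fun i => ρ ((1 : Fin (k.val + 2)).succAbove i)) else
      d₂ k (fun i => ρ ((1 : Fin (k.val + 2)).succAbove i))), fun b β r => ?_⟩
  have h1 : ∀ k : Fin N, (Fin.castLE (Nat.succ_le_succ k.succ.isLt.le) (1 : Fin (k.val + 2)) :
      Fin (N + 2)) = 1 := fun k => rfl
  have h2 : ∀ (k : Fin N) (i : Fin (k.val + 1)),
      (Fin.castLE (Nat.succ_le_succ k.succ.isLt.le) ((1 : Fin (k.val + 2)).succAbove i) :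
        Fin (N + 2)) =
      (1 : Fin (N + 2)).succAbove (Fin.castLE (Nat.succ_le_succ k.isLt.le) i) := fun k i => by
    refine Fin.cases ?_ (fun i => ?_) i
    · rfl
    · ext
      simp [Fin.succAbove, Fin.lt_def]
  have h3 : ∀ k : Fin N, (1 : Fin (N + 2)).succAbove k.succ = k.succ.succ := fun k => by
    ext; simp [Fin.succAbove, Fin.lt_def]
  rw [martingaleTransform, Fin.sum_univ_succ]
  congr 1
  simp only [Fin.cases_succ, Fin.cons_succ]
  split_ifs with hr
  · rw [martingaleTransform]
    refine Finset.sum_congr rfl fun k _ => ?_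
    have h1' := h1 k
    have h2' := h2 k
    simp only [Fin.val_succ] at h1' h2' ⊢
    simp only [h1', h2', h3]
    rw [if_pos hr]
  · rw [martingaleTransform]
    refine Finset.sum_congr rfl fun k _ => ?_
    have h1' := h1 k
    have h2' := h2 k
    simp only [Fin.val_succ] at h1' h2' ⊢
    simp only [h1', h2', h3]
    rw [if_neg hr]

lemma sum_signs_insert_one {N : ℕ} (h : ℤˣ → (Fin (N + 1) → ℤˣ) → ℝ) :
    ∑ r : Fin (N + 2) → ℤˣ, h (r 1) (fun i => r ((1 : Fin (N + 2)).succAbove i)) =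
      ∑ r, h 1 r + ∑ r, h (-1) r := by
  rw [← (Fin.insertNthEquiv (fun _ : Fin (N + 2) => ℤˣ) 1).sum_comp, Fintype.sum_prod_type,
    show (Finset.univ : Finset ℤˣ) = {1, -1} from rfl, Finset.sum_pair (by decide)]
  simp [Fin.insertNthEquiv]

/-- Every value of `Reach` started at a point is attained by a martingale transform. -/
lemma Reach.exists_martingale {V : ℝ → ℝ → ℝ} {l : List ℤˣ} {x y v : ℝ} (h : Reach V l x y v) :
    ∃ (d : ∀ k : Fin l.length, (Fin (k.val + 1) → ℤˣ) → ℂ)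
      (F G : (Fin (l.length + 1) → ℤˣ) → ℝ),
      (∀ r, martingaleTransform 1 d r = F r) ∧ (∀ r, martingaleTransform l.get d r = G r) ∧
      v * 2 ^ (l.length + 1) = ∑ r, V (x + F r) (y + G r) := by
  induction h with
  | nil x y =>
    refine ⟨fun k => k.elim0, fun _ => 0, fun _ => 0, fun r => ?_, fun r => ?_, ?_⟩
    · simp [martingaleTransform]
    · simp [martingaleTransform]
    · simp [mul_comm]
  | cons b l x y δ v₁ v₂ _ _ ih₁ ih₂ =>
    obtain ⟨d₁, F₁, G₁, hF₁, hG₁, hv₁⟩ := ih₁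
    obtain ⟨d₂, F₂, G₂, hF₂, hG₂, hv₂⟩ := ih₂
    obtain ⟨d, hd⟩ := exists_joined_martingale (δ : ℂ) d₁ d₂
    have e1 : (1 : Fin (b :: l).length → ℤˣ) = (Fin.cons 1 1 : Fin (l.length + 1) → ℤˣ) := by
      ext i; refine Fin.cases ?_ (fun i => ?_) i <;> simp
    have e2 : (b :: l).get = (Fin.cons b l.get : Fin (l.length + 1) → ℤˣ) := by
      ext i; refine Fin.cases ?_ (fun i => ?_) i <;> simp
    refine ⟨d, fun r => δ * ((r 1 : ℤ) : ℝ) +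
        if r 1 = 1 then F₁ (fun i => r ((1 : Fin (l.length + 2)).succAbove i))
        else F₂ (fun i => r ((1 : Fin (l.length + 2)).succAbove i)),
      fun r => ((b : ℤ) : ℝ) * δ * ((r 1 : ℤ) : ℝ) +
        if r 1 = 1 then G₁ (fun i => r ((1 : Fin (l.length + 2)).succAbove i))
        else G₂ (fun i => r ((1 : Fin (l.length + 2)).succAbove i)), fun r => ?_, fun r => ?_, ?_⟩
    · rw [e1]
      refine (hd 1 1 r).trans ?_
      rw [hF₁, hF₂]
      by_cases hr : r 1 = 1 <;> simp [hr]
    · rw [e2]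
      refine (hd b l.get r).trans ?_
      rw [hG₁, hG₂]
      by_cases hr : r 1 = 1 <;> simp [hr]
    · have := sum_signs_insert_one (N := l.length) fun s r =>
        V (x + (δ * ((s : ℤ) : ℝ) + if s = 1 then F₁ r else F₂ r))
          (y + (((b : ℤ) : ℝ) * δ * ((s : ℤ) : ℝ) + if s = 1 then G₁ r else G₂ r))
      refine Eq.trans ?_ this.symm
      have hne : (-1 : ℤˣ) ≠ 1 := by decide
      simp only [if_true, hne, if_false, Units.val_one, Int.cast_one, mul_one, Units.val_neg,
        Int.cast_neg, mul_neg, ← add_assoc, ← sub_eq_add_neg]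
      rw [← hv₁, ← hv₂, List.length_cons]
      ring

/-- Without regularity of `w`, midpoint concavity yields dyadic weights only; weights 2⁻ⁿ suffice
for a limit at 0. -/
lemma dyadic_concave {w : ℝ → ℝ} (hw : ∀ s t, (w s + w t) / 2 ≤ w ((s + t) / 2)) (s t : ℝ) (n : ℕ) :
    (1 / 2) ^ n * w s + (1 - (1 / 2) ^ n) * w t ≤
      w ((1 / 2 : ℝ) ^ n * s + (1 - (1 / 2) ^ n) * t) := by
  induction n with
  | zero => simp
  | succ n ih =>
    have h := hw ((1 / 2 : ℝ) ^ n * s + (1 - (1 / 2) ^ n) * t) t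
    have e : ((1 / 2 : ℝ) ^ n * s + (1 - (1 / 2) ^ n) * t + t) / 2 =
        (1 / 2 : ℝ) ^ (n + 1) * s + (1 - (1 / 2) ^ (n + 1)) * t := by rw [pow_succ]; ring
    rw [e] at h
    refine le_trans ?_ h
    rw [pow_succ]
    linarith

/-- A homogeneous function of degree `p` that is midpoint concave along the directions `(1, ±1)`
can only majorise `V` if `V` is nonpositive at `(1 / p, 1 - 1 / p)`. -/
lemma zigzag_obstruction {p : ℝ} (hp : 1 < p) {W V : ℝ → ℝ → ℝ}
    (hmid : ∀ (b : ℤˣ) (x y δ : ℝ), (W (x + δ) (y + ((b : ℤ) : ℝ) * δ) +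
      W (x - δ) (y - ((b : ℤ) : ℝ) * δ)) / 2 ≤ W x y)
    (hVW : ∀ x y, V x y ≤ W x y)
    (hhom : ∀ c > 0, ∀ x y, c ^ p * W x y ≤ W (c * x) (c * y))
    (hVc : Continuous fun z : ℝ × ℝ => V z.1 z.2) (hVs : ∀ x y, V (-x) y = V x y) :
    V (1 / p) (1 - 1 / p) ≤ 0 := by
  have hp0 : 0 < p := by linarith
  set a : ℝ := 1 / p
  have ha : 0 < a := by positivity
  have hline : ∀ (b : ℤˣ) (n : ℕ) (x y x₁ y₁ x₂ y₂ : ℝ), y₁ - y = ((b : ℤ) : ℝ) * (x₁ - x) →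
      y₂ - y = ((b : ℤ) : ℝ) * (x₂ - x) → x = (1 / 2) ^ n * x₁ + (1 - (1 / 2) ^ n) * x₂ →
      (1 / 2) ^ n * W x₁ y₁ + (1 - (1 / 2) ^ n) * W x₂ y₂ ≤ W x y := by
    intro b n x y x₁ y₁ x₂ y₂ h₁ h₂ hx
    have h := dyadic_concave (w := fun s => W (x + s) (y + ((b : ℤ) : ℝ) * s)) (fun s t => by
      have := hmid b (x + (s + t) / 2) (y + ((b : ℤ) : ℝ) * ((s + t) / 2)) ((s - t) / 2)
      convert this using 4 <;> ring) (x₁ - x) (x₂ - x) n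
    have e : (1 / 2) ^ n * (x₁ - x) + (1 - (1 / 2) ^ n) * (x₂ - x) = 0 := by linarith
    simp only [e, ← h₁, ← h₂] at h
    simpa using h
  set w := W 0 1
  -- From (0, 1) one moves with slope -1 to (a, 1 - a), with probability θ, or to (-δ, 1 + δ); from
  -- the latter with slope 1 to (-a - δ, 1 + δ - a), with probability θ, or to (0, 1 + 2δ). Zero
  -- drift forces (1 - θ)δ = aθ. By homogeneity the return to the axis contributes φ(θ) W(0, 1).
  set δ : ℝ → ℝ := fun θ => a * θ / (1 - θ)
  set φ : ℝ → ℝ := fun θ => (1 - θ) ^ 2 * (1 + 2 * δ θ) ^ p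
  set θ : ℕ → ℝ := fun n => (1 / 2 : ℝ) ^ (n + 1)
  have hθ0 : ∀ n, 0 < θ n := fun n => by positivity
  have hθ1 : ∀ n, θ n < 1 := fun n => pow_lt_one₀ (by norm_num) (by norm_num) (Nat.succ_ne_zero n)
  have hθ : Tendsto θ atTop (𝓝 0) :=
    (tendsto_pow_atTop_nhds_zero_of_lt_one (by norm_num) (by norm_num)).comp (tendsto_add_atTop_nat 1)
  have key : ∀ n, V a (1 - a) + (1 - θ n) * V (-a - δ (θ n)) (1 + δ (θ n) - a) +
      (θ n)⁻¹ • (φ (0 + θ n) - φ 0) * w ≤ 0 := by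
    intro n
    have h0 := hθ0 n
    have h1 := hθ1 n
    have hδ : (1 - θ n) * δ (θ n) = a * θ n := by
      simp only [δ]; field_simp [(sub_pos.2 h1).ne']
    have hδ0 : 0 < δ (θ n) := div_pos (by positivity) (by linarith)
    have s1 := hline (-1) (n + 1) 0 1 a (1 - a) (-δ (θ n)) (1 + δ (θ n)) (by simp) (by simp)
      (by change 0 = θ n * a + (1 - θ n) * -δ (θ n); linarith)
    have s2 := hline 1 (n + 1) (-δ (θ n)) (1 + δ (θ n)) (-a - δ (θ n)) (1 + δ (θ n) - a) 0
      (1 + 2 * δ (θ n)) (by simp) (by simp; ring)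
      (by change -δ (θ n) = θ n * (-a - δ (θ n)) + (1 - θ n) * 0; linarith)
    change θ n * _ + (1 - θ n) * _ ≤ _ at s1 s2
    have s3 := hhom (1 + 2 * δ (θ n)) (by positivity) 0 1
    rw [mul_zero, mul_one] at s3
    have t1 := hVW a (1 - a)
    have t2 := hVW (-a - δ (θ n)) (1 + δ (θ n) - a)
    have h1' : 0 ≤ 1 - θ n := by linarith
    have hφ0 : φ 0 = 1 := by simp [φ, δ]
    rw [hφ0, zero_add, smul_eq_mul]
    refine nonpos_of_mul_nonpos_right ?_ h0
    have e : θ n * (V a (1 - a) + (1 - θ n) * V (-a - δ (θ n)) (1 + δ (θ n) - a) +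
        (θ n)⁻¹ * (φ (θ n) - 1) * w) = θ n * V a (1 - a) +
        (1 - θ n) * (θ n * V (-a - δ (θ n)) (1 + δ (θ n) - a)) + (φ (θ n) - 1) * w := by
      field_simp
    have s4 : (1 - θ n) * ((1 + 2 * δ (θ n)) ^ p * w) ≤ (1 - θ n) * W 0 (1 + 2 * δ (θ n)) := by
      gcongr
    have s5 : (1 - θ n) * (θ n * V (-a - δ (θ n)) (1 + δ (θ n) - a) +
        (1 - θ n) * ((1 + 2 * δ (θ n)) ^ p * w)) ≤ (1 - θ n) * W (-δ (θ n)) (1 + δ (θ n)) := by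
      refine mul_le_mul_of_nonneg_left (le_trans (add_le_add ?_ s4) s2) h1'
      gcongr
    have s6 : θ n * V a (1 - a) ≤ θ n * W a (1 - a) := by gcongr
    have e2 : φ (θ n) * w = (1 - θ n) * ((1 - θ n) * ((1 + 2 * δ (θ n)) ^ p * w)) := by
      simp only [φ]; ring
    rw [e]
    linarith
  have hδd : HasDerivAt δ a 0 := by
    have h1 : HasDerivAt (fun θ : ℝ => a * θ) a 0 := by simpa using (hasDerivAt_id (0 : ℝ)).const_mul a
    have h2 : HasDerivAt (fun θ : ℝ => 1 - θ) (-1) 0 := (hasDerivAt_id (0 : ℝ)).const_sub 1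
    exact (h1.div h2 (by norm_num)).congr_deriv (by simp)
  -- The derivative is -2 + 2pa, which vanishes for a = 1/p. This choice of a eliminates the unknown
  -- W(0, 1) from the limit.
  have hφd : HasDerivAt φ 0 0 := by
    have h2 : HasDerivAt (fun θ : ℝ => (1 - θ) ^ 2) (-2) 0 := by
      exact (((hasDerivAt_id (0 : ℝ)).const_sub 1).pow 2).congr_deriv (by simp)
    have h3 : HasDerivAt (fun θ : ℝ => (1 + 2 * δ θ) ^ p) 2 0 := by
      have h4 := ((hδd.const_mul 2).const_add 1).rpow_const (p := p) (Or.inr hp.le)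
      convert h4 using 1
      simp [δ, a]
      field_simp
    exact (h2.mul h3).congr_deriv (by simp [δ])
  have hslope := hasDerivAt_iff_tendsto_slope_zero.1 hφd
  have hθ' : Tendsto θ atTop (𝓝[≠] 0) :=
    tendsto_nhdsWithin_iff.2 ⟨hθ, Eventually.of_forall fun n => (hθ0 n).ne'⟩
  have hδl : Tendsto (fun n => δ (θ n)) atTop (𝓝 0) := by
    have := hδd.continuousAt.tendsto.comp hθ
    rwa [show δ 0 = 0 by simp [δ]] at this
  have hVl : Tendsto (fun n => V (-a - δ (θ n)) (1 + δ (θ n) - a)) atTop (𝓝 (V a (1 - a))) := by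
    have h1 : Tendsto (fun n => ((-a - δ (θ n), 1 + δ (θ n) - a) : ℝ × ℝ)) atTop
        (𝓝 (-a, 1 - a)) := by
      refine Tendsto.prodMk_nhds ?_ ?_
      · simpa using hδl.const_sub (-a)
      · simpa using (hδl.const_add 1).sub_const a
    have h2 := (hVc.tendsto _).comp h1
    simp only [hVs] at h2
    exact h2
  have hlim := (((hθ.const_sub 1).mul hVl).const_add (V a (1 - a))).add
    ((hslope.comp hθ').mul_const w)
  have := le_of_tendsto' hlim key
  simp only [sub_zero, one_mul, zero_mul, add_zero] at this
  linarith

/-! ### The Bellman function and the explicit constant -/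

/-- The Bellman function of the zigzag problem. -/
def bellman (V : ℝ → ℝ → ℝ) (x y : ℝ) : ℝ := sSup {v | ∃ l, Reach V l x y v}

section bellman
variable {V : ℝ → ℝ → ℝ} (h0 : ∀ l v, Reach V l 0 0 v → v ≤ 0)
include h0

/-- Two steps lead from the origin to (x, y), through the diagonal point ((x + y)/2, (x + y)/2). The
other outcomes stop at (y, x) and at the opposite diagonal point, so `h0` bounds v. -/
lemma bddAbove_reach (x y : ℝ) : BddAbove {v | ∃ l, Reach V l x y v} := by
  refine ⟨-V y x - 2 * V (-((x + y) / 2)) (-((x + y) / 2)), ?_⟩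
  rintro v ⟨l, h⟩
  have h1 : Reach V (-1 :: (l ++ [])) ((x + y) / 2) ((x + y) / 2) ((v + V y x) / 2) := by
    refine Reach.step (-1) ((x - y) / 2) ?_ ?_
    · convert h using 1 <;> push_cast <;> ring
    · convert Reach.nil (V := V) y x using 1 <;> push_cast <;> ring
  have h2 := Reach.step (V := V) (x := 0) (y := 0) 1 ((x + y) / 2) (by simpa using h1)
    (by simpa using Reach.nil (V := V) _ _)
  have := h0 _ _ h2
  linarith

lemma le_bellman {l : List ℤˣ} {x y v : ℝ} (h : Reach V l x y v) : v ≤ bellman V x y :=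
  le_csSup (bddAbove_reach h0 x y) ⟨l, h⟩

/-- A step followed by arbitrary martingales from its two endpoints competes in the supremum at the
midpoint. -/
lemma bellman_midpoint (b : ℤˣ) (x y δ : ℝ) :
    (bellman V (x + δ) (y + ((b : ℤ) : ℝ) * δ) + bellman V (x - δ) (y - ((b : ℤ) : ℝ) * δ)) / 2 ≤
      bellman V x y := by
  have hne : ∀ x y, {v | ∃ l, Reach V l x y v}.Nonempty := fun x y => ⟨_, [], Reach.nil x y⟩
  have h1 : ∀ v₂ ∈ {v | ∃ l, Reach V l (x - δ) (y - ((b : ℤ) : ℝ) * δ) v},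
      bellman V (x + δ) (y + ((b : ℤ) : ℝ) * δ) ≤ 2 * bellman V x y - v₂ := by
    rintro v₂ ⟨l₂, h₂⟩
    refine csSup_le (hne _ _) ?_
    rintro v₁ ⟨l₁, h₁⟩
    have := le_bellman h0 (Reach.step b δ h₁ h₂)
    linarith
  have h2 : bellman V (x - δ) (y - ((b : ℤ) : ℝ) * δ) ≤
      2 * bellman V x y - bellman V (x + δ) (y + ((b : ℤ) : ℝ) * δ) :=
    csSup_le (hne _ _) fun v₂ hv₂ => by linarith [h1 v₂ hv₂]
  linarith

lemma bellman_scale {c s : ℝ} (hs : 0 < s) (hV : ∀ x y, V (c * x) (c * y) = s * V x y) (x y : ℝ) :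
    s * bellman V x y ≤ bellman V (c * x) (c * y) := by
  rw [← le_div_iff₀' hs]
  refine csSup_le ⟨_, [], Reach.nil x y⟩ ?_
  rintro v ⟨l, h⟩
  rw [le_div_iff₀' hs]
  exact le_bellman h0 (h.scale hV)

end bellman

/-- The functional whose expectation decides the martingale inequality with constant `A`. -/
def burkholderFun (p τ A x y : ℝ) : ℝ := √(y ^ 2 + (|τ| * |x|) ^ 2) ^ p - A ^ p * |x| ^ p

lemma burkholderFun_mul {p τ A c : ℝ} (hc : 0 < c) (x y : ℝ) :
    burkholderFun p τ A (c * x) (c * y) = c ^ p * burkholderFun p τ A x y := by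
  have e : (c * y) ^ 2 + (|τ| * |c * x|) ^ 2 = c ^ 2 * (y ^ 2 + (|τ| * |x|) ^ 2) := by
    rw [abs_mul, abs_of_pos hc]; ring
  rw [burkholderFun, e, Real.sqrt_mul (sq_nonneg c), Real.sqrt_sq hc.le,
    Real.mul_rpow hc.le (Real.sqrt_nonneg _), abs_mul, abs_of_pos hc,
    Real.mul_rpow hc.le (abs_nonneg _), burkholderFun]
  ring

lemma burkholderFun_nonpos_iff {p τ A x y : ℝ} (hp : 0 < p) (hA : 0 ≤ A) (hx : 0 < x) :
    burkholderFun p τ A x y ≤ 0 ↔ √((y / x) ^ 2 + τ ^ 2) ≤ A := by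
  have e : y ^ 2 + (|τ| * |x|) ^ 2 = x ^ 2 * ((y / x) ^ 2 + τ ^ 2) := by
    rw [mul_pow, sq_abs, sq_abs]; field_simp
  rw [burkholderFun, sub_nonpos, ← Real.mul_rpow hA (abs_nonneg _),
    Real.rpow_le_rpow_iff (Real.sqrt_nonneg _) (by positivity) hp, e, Real.sqrt_mul (sq_nonneg x),
    Real.sqrt_sq hx.le, abs_of_pos hx, mul_comm A, mul_le_mul_iff_right₀ hx]

lemma continuous_burkholderFun {p τ A : ℝ} (hp : 0 < p) :
    Continuous fun z : ℝ × ℝ => burkholderFun p τ A z.1 z.2 := by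
  unfold burkholderFun
  exact (Continuous.rpow_const (by fun_prop) fun _ => Or.inr hp.le).sub
    (continuous_const.mul (Continuous.rpow_const (by fun_prop) fun _ => Or.inr hp.le))

/-- The lower bound for the constant in the `τ`-perturbed martingale inequality. -/
theorem sqrt_pStar_le_of_martingale_bound {p : ℝ} (hp : 1 < p) (τ : ℝ) {A : ℝ} (hA : 0 ≤ A)
    (h : ∀ (N : ℕ) (β : Fin N → ℤˣ) (d : ∀ k : Fin N, (Fin (k.val + 1) → ℤˣ) → ℂ),
      ∑ r, ‖hilbertPair τ (martingaleTransform β d r) (martingaleTransform 1 d r)‖ ^ p ≤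
        A ^ p * ∑ r, ‖martingaleTransform 1 d r‖ ^ p) :
    √((pStar p - 1) ^ 2 + τ ^ 2) ≤ A := by
  have hp0 : 0 < p := by linarith
  set V := burkholderFun p τ A
  have h0 : ∀ l v, Reach V l 0 0 v → v ≤ 0 := by
    intro l v hr
    obtain ⟨d, F, G, hF, hG, hv⟩ := hr.exists_martingale
    have := h l.length l.get d
    simp only [hF, hG, norm_hilbertPair, norm_real, Real.norm_eq_abs, sq_abs] at this
    have h2 : v * 2 ^ (l.length + 1) ≤ 0 := by
      rw [hv]
      simp only [zero_add, V, burkholderFun, Finset.sum_sub_distrib, ← Finset.mul_sum]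
      linarith
    exact nonpos_of_mul_nonpos_left h2 (by positivity)
  have hs : ∀ c > 0, ∀ x y, c ^ p * bellman V x y ≤ bellman V (c * x) (c * y) := fun c hc x y =>
    bellman_scale h0 (by positivity) (burkholderFun_mul hc) x y
  have hVc : Continuous fun z : ℝ × ℝ => V z.1 z.2 := continuous_burkholderFun hp0
  have h1 := zigzag_obstruction hp (bellman_midpoint h0) (fun x y => le_bellman h0 (Reach.nil x y))
    hs hVc (fun x y => by simp [V, burkholderFun])
  -- Exchanging the coordinates preserves the lines of slope ±1, so the obstruction also applies to
  -- the reflected functions.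
  have h2 := zigzag_obstruction (W := fun x y => bellman V y x) (V := fun x y => V y x) hp
    (fun b x y δ => by
      have := bellman_midpoint h0 b y x (((b : ℤ) : ℝ) * δ)
      have hb : ((b : ℤ) : ℝ) * (((b : ℤ) : ℝ) * δ) = δ := by
        rw [← mul_assoc, ← Int.cast_mul, ← Units.val_mul, Int.units_mul_self]; simp
      rwa [hb] at this)
    (fun x y => le_bellman h0 (Reach.nil y x)) (fun c hc x y => hs c hc y x)
    (hVc.comp continuous_swap) (fun x y => by simp [V, burkholderFun])
  have hp1 : 0 < p - 1 := by linarith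
  rw [burkholderFun_nonpos_iff hp0 hA (by positivity)] at h1
  rw [burkholderFun_nonpos_iff hp0 hA (by rw [sub_pos, div_lt_one hp0]; exact hp)] at h2
  rw [pStar]
  -- The two test points have slopes y/x equal to p - 1 and to 1/(p - 1) = p/(p - 1) - 1.
  rcases max_choice p (p / (p - 1)) with hm | hm <;> rw [hm]
  · convert h1 using 4
    field_simp
  · convert h2 using 4
    field_simp
    ring

/-! ### Conclusion -/

lemma martingaleConst_le_of_bound {p τ A : ℝ} (hp : 1 < p) (hA : 0 ≤ A)
    (h : ∀ (N : ℕ) (β : Fin N → ℤˣ) (d : ∀ k : Fin N, (Fin (k.val + 1) → ℤˣ) → ℂ),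
      ∑ r, ‖hilbertPair τ (martingaleTransform β d r) (martingaleTransform 1 d r)‖ ^ p ≤
        A ^ p * ∑ r, ‖martingaleTransform 1 d r‖ ^ p) :
    martingaleConst τ p p ≤ ENNReal.ofReal A := by
  have hp0 : 0 < p := by linarith
  refine iSup_le fun N => iSup_le fun β => iSup_le fun d => ENNReal.ofReal_le_ofReal ?_
  -- A vanishing denominator is covered, the quotient then being 0 by convention.
  refine div_le_of_le_mul₀ (Real.rpow_nonneg (by positivity) _) hA ?_
  simp only [signLpNorm]
  have hd : A ^ p * (∑ r, ‖martingaleTransform 1 d r‖ ^ p) / 2 ^ (N + 1) =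
      A ^ p * ((∑ r, ‖martingaleTransform 1 d r‖ ^ p) / 2 ^ (N + 1)) := mul_div_assoc _ _ _
  have h1 := Real.rpow_le_rpow (z := 1 / p) (by positivity)
    (div_le_div_of_nonneg_right (h N β d) (by positivity : (0 : ℝ) ≤ 2 ^ (N + 1))) (by positivity)
  rw [hd, Real.mul_rpow (by positivity) (by positivity), one_div, Real.rpow_rpow_inv hA hp0.ne'] at h1
  rw [one_div]
  exact h1

lemma IsMultiplierOf.vectorMultiplierNorm_congr {m m' k : ℂ → ℝ} (hm : IsMultiplierOf m k)
    (hm' : IsMultiplierOf m' k) (τ p p₀ : ℝ) :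
    vectorMultiplierNorm ![fun ξ => (m ξ : ℂ), fun _ => (τ : ℂ)] p p₀ =
      vectorMultiplierNorm ![fun ξ => (m' ξ : ℂ), fun _ => (τ : ℂ)] p p₀ := by
  have : ∀ f : 𝓢(ℂ, ℂ), vectorMultiplierOp ![fun ξ => (m ξ : ℂ), fun _ => (τ : ℂ)] f =
      vectorMultiplierOp ![fun ξ => (m' ξ : ℂ), fun _ => (τ : ℂ)] f := fun f => by
    ext1 z
    rw [vectorMultiplierOp_eq_hilbertPair, vectorMultiplierOp_eq_hilbertPair,
      hm.multiplierOp_congr hm']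
  simp only [vectorMultiplierNorm, this]

end

theorem corollary7 (p : ℝ) (hp : 1 < p) (τ : ℝ) (k : ℂ → ℝ)
    (hk : k = reBeurlingKernel ∨ k = imBeurlingKernel) :
    (∃ m : ℂ → ℝ, IsMultiplierOf m k) ∧
    ∀ m : ℂ → ℝ, IsMultiplierOf m k →
      (IsGreatest (m '' Metric.sphere (0 : ℂ) 1) 1 ∧
        IsLeast (m '' Metric.sphere (0 : ℂ) 1) (-1)) ∧
      martingaleConst τ p p ≤
        vectorMultiplierNorm ![fun ξ => (m ξ : ℂ), fun _ => (τ : ℂ)] p p ∧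
      ((p < 2 ∧ τ ^ 2 ≤ pStar p - 1) ∨ 2 ≤ p →
        ENNReal.ofReal (Real.sqrt ((pStar p - 1) ^ 2 + τ ^ 2)) ≤
          vectorMultiplierNorm ![fun ξ => (m ξ : ℂ), fun _ => (τ : ℂ)] p p) := by
  obtain ⟨m₀, hm₀, hom, hbd, hu⟩ := exists_symbol_of_beurling hk
  refine ⟨⟨m₀, hm₀⟩, fun m hm => ?_⟩
  have heq : ∀ ξ ∈ Metric.sphere (0 : ℂ) 1, m ξ = m₀ ξ := fun ξ hξ =>
    hm.eqOn hm₀ (by rintro rfl; simp at hξ)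
  have hval : ∀ b : ℤˣ, ((b : ℤ) : ℝ) ∈ m '' Metric.sphere (0 : ℂ) 1 := fun b => by
    obtain ⟨u, hu1, hu2⟩ := hu b
    have hmem : u ∈ Metric.sphere (0 : ℂ) 1 := by simpa using hu1
    exact ⟨u, hmem, (heq u hmem).trans hu2⟩
  refine ⟨⟨⟨by simpa using hval 1, ?_⟩, by simpa using hval (-1), ?_⟩, ?_⟩
  · rintro _ ⟨ξ, hξ, rfl⟩
    rw [heq ξ hξ]; exact (abs_le.1 (hbd ξ)).2
  · rintro _ ⟨ξ, hξ, rfl⟩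
    rw [heq ξ hξ]; exact (abs_le.1 (hbd ξ)).1
  rw [hm.vectorMultiplierNorm_congr hm₀]
  set Q := vectorMultiplierNorm ![fun ξ => (m₀ ξ : ℂ), fun _ => (τ : ℂ)] p p with hQ
  -- Transference needs a finite constant A; for an infinite norm both inequalities are trivial.
  rcases eq_or_ne Q ⊤ with htop | htop
  · rw [htop]; exact ⟨le_top, fun _ => le_top⟩
  have hmeas : Measurable m₀ := measurable_of_continuousOn_compl_singleton 0 hm₀.continuousOn
  have hbound := fun (N : ℕ) (β : Fin N → ℤˣ) (d : ∀ k : Fin N, (Fin (k.val + 1) → ℤˣ) → ℂ) =>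
    martingale_transference hmeas hbd hm₀.continuousOn hom hu hp τ (A := Q.toReal)
      (ENNReal.ofReal_toReal htop).ge ENNReal.toReal_nonneg β d
  rw [← ENNReal.ofReal_toReal htop]
  exact ⟨martingaleConst_le_of_bound hp ENNReal.toReal_nonneg hbound, fun _ =>
    ENNReal.ofReal_le_ofReal
      (sqrt_pStar_le_of_martingale_bound hp τ ENNReal.toReal_nonneg hbound)⟩
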